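/- Let $\mathcal A$ be a commutative ring, $k$ an algebraically closed field that is an $\mathcal A$-algebra, and let $\beta=(b_1,\dots,b_n)\in\mathbb Q^n$ satisfy $0<b_i\le 1$ and $|\beta|=\sum b_i>r$. Let $U\subset\mathbb P^{n-1}\times\mathrm{Gr}(r,n)$ be the universal family of linear subspaces $\mathbb PV\subset\mathbb P^{n-1}$ ($V\subset\mathbb A^n$ of dimension $r$), with coordinates $z_i$ on $\mathbb P^{n-1}$ and Plücker coordinates $p_I$ on $\mathrm{Gr}(r,n)$. The torus $T=\mathbb G_m^n/\mathrm{diag}(\mathbb G_m)$ acts on $U$; $z_i$ has character $e_i$ and $p_I$ has character $e_I:=\sum_{i\in I}e_i$ in $\mathbb Z^n$. Polarize $U$ by the $\mathbb Q$-line bundle $p_1^*\mathcal O(|\beta|-r)\otimes p_2^*\mathcal O(1)$ with the $T$-linearization given by $\beta$: the invariant sections of its $N$-th power, for $N\ge1$ with $N\beta$ integral, are the classes of the polynomials over $\mathcal A$ in the $z_i,p_I$ of bidegree $(N(|\beta|-r),N)$ and character $N\beta$. A point $p\in U(k)$ is $\beta$-semistable if some such section, for some $N\ge 1$, does not vanish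 at $p$; it is $\beta$-stable if in addition its $T$-orbit is closed in the semistable locus of $U_k$ and its stabilizer in $T$ is finite. For $V\in\mathrm{Gr}(r,n)(k)$ let $P_V\subset\mathbb R^n$ be the matroid polytope, the convex hull of the $e_I$ with $p_I(V)\ne0$, let $\Delta_\beta=\{x\in\mathbb R^n : 0\le x_i\le b_i,\ \sum x_i=r\}$, let $\mathrm{Int}\,\Delta_\beta$ be its relative interior, and let $B_i=\{z_i=0\}\cap\mathbb PV$. The pair $(\mathbb PV,\sum b_iB_i)$ is lc (respectively klt) at $p\in\mathbb PV$ if no $B_i$ is all of $\mathbb PV$ and, for every nonempty $I\subset\{1,\dots,n\}$ with $p\in\bigcap_{i\in I}B_i$, one has $\sum_{i\in I}b_i\le\mathrm{codim}\bigcap_{i\in I}B_i$ (respectively $<$). Then, for every $V\in\mathrm{Gr}(r,n)(k)$: 1. If $P_V\cap\Delta_\beta=\emptyset$, or $V\subset\{z_i=0\}$ for some $i$, then no $p\in\mathbb PV$ is $\beta$-semistable. 2. If $P_V\cap\Delta_\beta\ne\emptyset$, then for every $p\in\mathbb PV$: $p$ is $\beta$-semistable if and only if $(\mathbb PV,\sum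 b_iB_i)$ is lc at $p$. 3. If $P_V\cap\mathrm{Int}\,\Delta_\beta\ne\emptyset$, then for every $p\in\mathbb PV$: $p$ is $\beta$-stable if and only if $(\mathbb PV,\sum b_iB_i)$ is klt at $p$. -/

import Mathlib

open scoped LinearAlgebra.Projectivization Pointwise

namespace HyperplaneGIT

noncomputable section

/-! ### Weights and polytopes -/

/-- The weight domain: rational weights `b` with `0 < b i ≤ 1` and `∑ b i > r`. -/
def weightDomain (r n : ℕ) : Set (Fin n → ℚ) :=
  {b | (∀ i, 0 < b i ∧ b i ≤ 1) ∧ (r : ℚ) < ∑ i, b i}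

/-- The weighted hypersimplex `Δ_β(r,n) = {0 ≤ x i ≤ b i, ∑ x i = r}` in `ℝⁿ`. -/
def weightedHypersimplex (r : ℕ) {n : ℕ} (b : Fin n → ℚ) : Set (Fin n → ℝ) :=
  {x | (∀ i, 0 ≤ x i ∧ x i ≤ (b i : ℝ)) ∧ ∑ i, x i = (r : ℝ)}

/-- The `r`-element subsets of `{0, …, n-1}`, which index the Plücker coordinates. -/
abbrev PluckerIndex (r n : ℕ) : Type := {I : Finset (Fin n) // I.card = r}

/-! ### The grassmannian and its universal family (points over a field `k`) -/

/-- The `k`-points of the grassmannian of `r`-dimensional subspaces of `kⁿ`. -/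
abbrev Gr (k : Type*) [Field k] (r n : ℕ) : Type _ :=
  {V : Submodule k (Fin n → k) // Module.finrank k V = r}

/-- The coordinate hyperplane `H i = {z i = 0}`, as a linear subspace of `kⁿ`. -/
def coordHyperplane (k : Type*) [Field k] {n : ℕ} (i : Fin n) : Submodule k (Fin n → k) :=
  LinearMap.ker (LinearMap.proj i : (Fin n → k) →ₗ[k] k)

/-- The `k`-points `(p, V)`, `p ∈ ℙV`, of the universal family `U ⊆ ℙⁿ⁻¹ × Gr(r,n)`. -/
@[ext]
structure UniversalFamily (k : Type*) [Field k] (r n : ℕ) where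
  /-- the point `p` of `ℙⁿ⁻¹` -/
  point : ℙ k (Fin n → k)
  /-- the linear space `V` -/
  space : Gr k r n
  point_mem : point.submodule ≤ space.1

variable {k : Type*} [Field k] {r n : ℕ}

/-- The Plücker coordinates of the subspace spanned by the rows `w`: the `I`-th one is the
maximal minor on the columns in `I`. -/
def minors (w : Fin r → Fin n → k) (I : PluckerIndex r n) : k :=
  Matrix.det (Matrix.of fun a c : Fin r => w a (I.1.orderEmbOfFin I.2 c))

/-- Plücker coordinates of `V`, with respect to some basis of `V`
(another basis multiplies all of them by one common nonzero scalar). -/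
def plucker (V : Gr k r n) : PluckerIndex r n → k :=
  minors fun a => ((Module.finBasisOfFinrankEq k V.1 V.2 a : V.1) : Fin n → k)

/-- The weight `∑_{i ∈ I} e i` of the Plücker coordinate `p_I`, as a point of `ℝⁿ`. -/
def indicatorPoint (I : PluckerIndex r n) : Fin n → ℝ := fun i => if i ∈ I.1 then 1 else 0

/-- The matroid polytope `P_V`: the moment polytope of `V`, that is, the convex hull of the
weights of the Plücker coordinates that do not vanish at `V`. -/
def matroidPolytope (V : Gr k r n) : Set (Fin n → ℝ) :=
  convexHull ℝ {x | ∃ I : PluckerIndex r n, plucker V I ≠ 0 ∧ x = indicatorPoint I}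

/-! ### Sections and the Zariski topology on the universal family -/

/-- The index set of the coordinates `z i` and `p_I` on `ℙⁿ⁻¹ × ℙ(⋀ʳ kⁿ)`. -/
abbrev Coord (r n : ℕ) : Type := Fin n ⊕ PluckerIndex r n

/-- The values of the coordinates `z i`, `p_I` at a point of `U`, for some choice of homogeneous
coordinates. Whether a bihomogeneous polynomial vanishes does not depend on the choice. -/
def UniversalFamily.coord (x : UniversalFamily k r n) : Coord r n → k :=
  Sum.elim x.point.rep (plucker x.space)

/-- The bidegree: `z i` has bidegree `(1,0)` and `p_I` has bidegree `(0,1)`. -/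
def bidegree (r n : ℕ) : Coord r n → ℕ × ℕ :=
  Sum.elim (fun _ => (1, 0)) (fun _ => (0, 1))

/-- The `ℤⁿ`-character: `z i` has character `e i` and `p_I` has character `∑_{i ∈ I} e i`. -/
def character (r n : ℕ) : Coord r n → Fin n → ℕ :=
  Sum.elim (fun i j => if j = i then 1 else 0) (fun I j => if j ∈ I.1 then 1 else 0)

/-- The Zariski topology on the `k`-points of `U ⊆ ℙⁿ⁻¹ × ℙ(⋀ʳ kⁿ)`: a basis of open sets is
given by the nonvanishing loci of bihomogeneous polynomials in the `z i` and `p_I`. -/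
instance : TopologicalSpace (UniversalFamily k r n) :=
  TopologicalSpace.generateFrom
    {W | ∃ (d : ℕ × ℕ) (F : MvPolynomial (Coord r n) k),
      MvPolynomial.IsWeightedHomogeneous (bidegree r n) F d ∧
      W = {x | MvPolynomial.aeval x.coord F ≠ 0}}

/-- `s ∈ A[z i, p_I]` represents a `T`-invariant section of the `N`-th power of the `ℚ`-line bundle
`L_{|β|-r, 1}` on `U` over `A`, for the linearization given by `β`: it has bidegree
`N • (|β| - r, 1)` and its `ℤⁿ`-character is `N • β`. -/
def IsInvariantSection {A : Type*} [CommRing A] (b : Fin n → ℚ) (N : ℕ)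
    (s : MvPolynomial (Coord r n) A) : Prop :=
  ∃ (a : ℕ) (c : Fin n → ℕ), (a : ℚ) = N * (∑ i, b i - r) ∧ (∀ i, (c i : ℚ) = N * b i) ∧
    MvPolynomial.IsWeightedHomogeneous (bidegree r n) s (a, N) ∧
    MvPolynomial.IsWeightedHomogeneous (character r n) s c

/-- A geometric point of `U` is `β`-semistable if some invariant section (defined over the base
ring `A`) of a positive power of the polarization does not vanish at it. -/
def IsSemistable (A : Type*) [CommRing A] [Algebra A k] (b : Fin n → ℚ)
    (x : UniversalFamily k r n) : Prop :=
  ∃ (N : ℕ) (s : MvPolynomial (Coord r n) A), 0 < N ∧ IsInvariantSection b N s ∧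
    MvPolynomial.aeval x.coord s ≠ 0

/-! ### The torus action -/

/-- The coordinatewise action of `𝔾_mⁿ` on `kⁿ` is linear. -/
instance : SMulCommClass (Fin n → kˣ) k (Fin n → k) :=
  ⟨fun t c v => funext fun i => smul_comm (t i) c (v i)⟩

/-- The big torus `𝔾_mⁿ` acts on `U`, through its coordinatewise action on `kⁿ`. -/
instance : MulAction (Fin n → kˣ) (UniversalFamily k r n) where
  smul t x :=
    { point := t • x.point
      space := ⟨t • x.space.1, by
        have h := LinearEquiv.finrank_map_eq
          (DistribMulAction.toLinearEquiv k (Fin n → k) t) x.space.1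
        exact h.trans x.space.2⟩
      point_mem := by
        obtain ⟨p, V, h⟩ := x
        induction p using Projectivization.ind with
        | h v hv =>
          rw [Projectivization.smul_mk]
          rw [Projectivization.submodule_mk, Submodule.span_singleton_le_iff_mem] at h ⊢
          exact Submodule.smul_mem_pointwise_smul v t V.1 h }
  one_smul x := UniversalFamily.ext (one_smul _ x.point) (Subtype.ext (one_smul _ x.space.1))
  mul_smul s t x :=
    UniversalFamily.ext (mul_smul s t x.point) (Subtype.ext (mul_smul s t x.space.1))

/-- The diagonal `𝔾_m` in `𝔾_mⁿ`. -/
def diagonal (k : Type*) [Field k] (n : ℕ) : Subgroup (Fin n → kˣ) :=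
  (MonoidHom.pi fun _ : Fin n => MonoidHom.id kˣ).range

/-- The torus `T = 𝔾_mⁿ / diag 𝔾_m`. -/
abbrev Torus (k : Type*) [Field k] (n : ℕ) : Type _ := (Fin n → kˣ) ⧸ diagonal k n

theorem diagonal_smul (t : Fin n → kˣ) (ht : t ∈ diagonal k n) (x : UniversalFamily k r n) :
    t • x = x := by
  obtain ⟨c, rfl⟩ := ht
  have hc : ∀ v : Fin n → k,
      ((MonoidHom.pi fun _ : Fin n => MonoidHom.id kˣ) c) • v = (c : k) • v := fun v => rfl
  refine UniversalFamily.ext ?_ (Subtype.ext ?_)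
  · change _ • x.point = x.point
    induction x.point using Projectivization.ind with
    | h v hv =>
      rw [Projectivization.smul_mk, Projectivization.mk_eq_mk_iff']
      exact ⟨c, (hc v).symm⟩
  · change _ • x.space.1 = x.space.1
    ext v
    rw [Submodule.mem_smul_pointwise_iff_exists]
    constructor
    · rintro ⟨w, hw, rfl⟩
      rw [hc]
      exact x.space.1.smul_mem _ hw
    · intro hv
      refine ⟨((c⁻¹ : kˣ) : k) • v, x.space.1.smul_mem _ hv, ?_⟩
      rw [hc, smul_smul, Units.mul_inv, one_smul]

/-- The induced action of the torus `T` on `U`. -/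
instance : MulAction (Torus k n) (UniversalFamily k r n) :=
  MulAction.compHom (UniversalFamily k r n)
    (QuotientGroup.lift (diagonal k n) (MulAction.toPermHom (Fin n → kˣ) (UniversalFamily k r n))
      (fun t ht => Equiv.ext fun x => diagonal_smul t ht x))

/-- A geometric point of `U` is (properly) `β`-stable if it is `β`-semistable, its `T`-orbit is
closed in the semistable locus, and its stabilizer in `T` is finite. -/
def IsStable (A : Type*) [CommRing A] [Algebra A k] (b : Fin n → ℚ)
    (x : UniversalFamily k r n) : Prop :=
  IsSemistable A b x ∧
  IsClosed ((Subtype.val : {y : UniversalFamily k r n // IsSemistable A b y} → _) ⁻¹'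
    MulAction.orbit (Torus k n) x) ∧
  Finite (MulAction.stabilizer (Torus k n) x)

/-! ### Singularities of the pair `(ℙV, ∑ b i B i)`, where `B i = H i ∩ ℙV` -/

/-- The linear subspace of `V` whose projectivization is the intersection `⋂_{i ∈ I} B i`. -/
def intersection (V : Gr k r n) (I : Finset (Fin n)) : Submodule k (Fin n → k) :=
  V.1 ⊓ ⨅ i ∈ I, coordHyperplane k i

/-- The codimension of `⋂_{i ∈ I} B i` in `ℙV`, as a rational number. -/
def codim (V : Gr k r n) (I : Finset (Fin n)) : ℚ :=
  (Module.finrank k V.1 : ℚ) - Module.finrank k (intersection V I)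

/-- `∑ b i B i` is a divisor on `ℙV`: every `B i` that occurs in it is a hyperplane of `ℙV`, that
is, `ℙV` is not contained in `H i`. -/
def IsDivisor (b : Fin n → ℚ) (V : Gr k r n) : Prop :=
  ∀ i, b i ≠ 0 → ¬ V.1 ≤ coordHyperplane k i

/-- The hyperplane arrangement `(ℙV, ∑ b i B i)` is log canonical at `p`: it is a pair, and for each
intersection `⋂_{i ∈ I} B i` through `p`, of codimension `c`, one has `∑_{i ∈ I} b i ≤ c`. -/
def IsLCAt (b : Fin n → ℚ) (x : UniversalFamily k r n) : Prop :=
  IsDivisor b x.space ∧ ∀ I : Finset (Fin n), I.Nonempty →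
    x.point.submodule ≤ intersection x.space I → ∑ i ∈ I, b i ≤ codim x.space I

/-- The hyperplane arrangement `(ℙV, ∑ b i B i)` is Kawamata log terminal at `p`: the inequalities
that define log canonical are strict. -/
def IsKLTAt (b : Fin n → ℚ) (x : UniversalFamily k r n) : Prop :=
  IsDivisor b x.space ∧ ∀ I : Finset (Fin n), I.Nonempty →
    x.point.submodule ≤ intersection x.space I → ∑ i ∈ I, b i < codim x.space I

end

end HyperplaneGIT

open HyperplaneGIT

/-!
A section of the polarization that does not vanish at `x = (p, V)` contains an invariant monomial
`∏ z_i ^ a_i * ∏ p_I ^ m_I` that does not vanish at `x`. Invariance under the `N`-th power of the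
linearization says that the point `y = ∑ (m_I / N) e_I` of `P_V` satisfies `y_i = b_i - a_i / N`.
Since real weights can be perturbed to rational ones, `x` is semistable iff `P_V` contains some
`y ≤ β` with `y_i = b_i` whenever `z_i(p) = 0`.

*Semistable versus lc.* Every `y ∈ P_V` satisfies `∑_{i ∈ C} y_i ≤ codim C`, which forces lc.
Conversely, maximize `∑_{z_i(p) = 0} y_i` over `y ∈ P_V` with `y ≤ β`. If `y_i < b_i` with
`z_i(p) = 0`, then the coordinates from which weight can be transferred to `i` form a set `C` of
coordinates vanishing at `p`; it is closed under basis exchange, so `∑_{i ∈ C} y_i = codim C`,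
which contradicts lc.

*Stable versus klt.* If `∑_{i ∈ C} b_i = codim C`, then the one-parameter subgroup of weight `0` on
`C` and `1` off `C` moves `x` to a semistable limit. Were `x` stable, the limit would lie in the
orbit of `x`, although its stabilizer is infinite. Conversely, if the pair is klt, some invariant
monomial involves exactly the coordinates that do not vanish at `x`, so a semistable point of the
orbit closure has the same nonvanishing coordinates as `x`. By klt their characters generate
the character lattice, so such a point lies in the orbit of `x`, and the stabilizer of `x` is
trivial.
-/

namespace HyperplaneGIT

noncomputable section

section Matroid

variable {k : Type*} [Field k] {r n : ℕ} {V : Gr k r n} {I : Finset (Fin n)}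

theorem mem_intersection {C : Finset (Fin n)} {v : Fin n → k} :
    v ∈ intersection V C ↔ v ∈ V.1 ∧ ∀ i ∈ C, v i = 0 := by
  simp [intersection, coordHyperplane]

theorem intersection_anti {C D : Finset (Fin n)} (h : C ⊆ D) :
    intersection V D ≤ intersection V C := fun _ hv =>
  mem_intersection.2 ⟨(mem_intersection.1 hv).1, fun i hi => (mem_intersection.1 hv).2 i (h hi)⟩

theorem codim_le_codim {C D : Finset (Fin n)} (h : intersection V D ≤ intersection V C) :
    codim V C ≤ codim V D :=
  sub_le_sub_left (Nat.cast_le.2 (Submodule.finrank_mono h)) _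

variable (V I) in
/-- `I` is a base of the matroid of `V`: it has `r` elements, and a vector of `V` is determined by
its coordinates in `I`. -/
def IsBase : Prop :=
  I.card = r ∧ ∀ v ∈ V.1, (∀ i ∈ I, v i = 0) → v = 0

variable (V I) in
/-- The projection of `V` to the coordinates in `I`; its rank is the rank of `I` in the matroid of
`V`. -/
def restrict : V.1 →ₗ[k] (I → k) :=
  LinearMap.pi fun i => LinearMap.proj i.1 ∘ₗ V.1.subtype

theorem map_ker_restrict : (LinearMap.ker (restrict V I)).map V.1.subtype = intersection V I := by
  ext v
  simp only [Submodule.mem_map, mem_intersection, LinearMap.mem_ker]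
  constructor
  · rintro ⟨w, hw, rfl⟩
    exact ⟨w.2, fun i hi => congrFun hw ⟨i, hi⟩⟩
  · rintro ⟨hv, h⟩
    exact ⟨⟨v, hv⟩, funext fun i => h i.1 i.2, rfl⟩

theorem codim_eq_finrank_range :
    codim V I = Module.finrank k (LinearMap.range (restrict V I)) := by
  rw [codim, ← map_ker_restrict, Submodule.finrank_map_subtype_eq,
    ← LinearMap.finrank_range_add_finrank_ker (restrict V I), Nat.cast_add, add_sub_cancel_right]

variable (V) in
theorem exists_isBase : ∃ I, IsBase V I := by
  obtain ⟨I, hI, hmin⟩ := exists_minimal_of_wellFoundedLT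
    (fun I : Finset (Fin n) => ∀ v ∈ V.1, (∀ i ∈ I, v i = 0) → v = 0)
    ⟨Finset.univ, fun v _ h => funext fun i => h i (Finset.mem_univ i)⟩
  have hinj : Function.Injective (restrict V I) := (injective_iff_map_eq_zero _).2 fun v hv =>
    Subtype.ext (hI v v.2 fun i hi => congrFun hv ⟨i, hi⟩)
  have hsingle : ∀ i : I, Pi.basisFun k I i ∈ LinearMap.range (restrict V I) := by
    intro i
    have hnot : ¬ ∀ v ∈ V.1, (∀ l ∈ I.erase i, v l = 0) → v = 0 := fun h =>
      Finset.notMem_erase i.1 I (hmin h (Finset.erase_subset _ _) i.2)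
    push Not at hnot
    obtain ⟨v, hv, hvI, hv0⟩ := hnot
    have hvi : v i ≠ 0 := fun h => hv0 <| hI v hv fun l hl => by
      by_cases hli : l = i
      · rw [hli, h]
      · exact hvI l (Finset.mem_erase.2 ⟨hli, hl⟩)
    refine ⟨(v i)⁻¹ • ⟨v, hv⟩, funext fun l => ?_⟩
    rcases eq_or_ne l i with rfl | hl
    · simp [restrict, hvi]
    · simp [restrict, hl, hvI l (Finset.mem_erase.2 ⟨Subtype.coe_ne_coe.2 hl, l.2⟩)]
  have hsurj : LinearMap.range (restrict V I) = ⊤ := top_le_iff.1 <|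
    (Pi.basisFun k I).span_eq ▸ Submodule.span_le.2 (Set.range_subset_iff.2 hsingle)
  refine ⟨I, ?_, hI⟩
  rw [← V.2, (LinearEquiv.ofBijective _ ⟨hinj, LinearMap.range_eq_top.1 hsurj⟩).finrank_eq,
    Module.finrank_fintype_fun_eq_card, Fintype.card_coe]

namespace IsBase

theorem eq_of_eqOn (hI : IsBase V I) {u v : Fin n → k} (hu : u ∈ V.1) (hv : v ∈ V.1)
    (h : ∀ i ∈ I, u i = v i) : u = v :=
  sub_eq_zero.1 <| hI.2 _ (V.1.sub_mem hu hv) fun i hi => sub_eq_zero.2 (h i hi)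

theorem restrict_surjective (hI : IsBase V I) : Function.Surjective (restrict V I) := by
  rw [← LinearMap.injective_iff_surjective_of_finrank_eq_finrank]
  · exact fun u v h => Subtype.ext (hI.eq_of_eqOn u.2 v.2 fun i hi => congrFun h ⟨i, hi⟩)
  · rw [V.2, Module.finrank_fintype_fun_eq_card, Fintype.card_coe, hI.1]

theorem exists_eqOn (hI : IsBase V I) (f : Fin n → k) : ∃ v ∈ V.1, ∀ i ∈ I, v i = f i := by
  obtain ⟨v, hv⟩ := hI.restrict_surjective fun i => f i
  exact ⟨v.1, v.2, fun i hi => congrFun hv ⟨i, hi⟩⟩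

theorem codim_subset (hI : IsBase V I) {J : Finset (Fin n)} (hJ : J ⊆ I) :
    codim V J = J.card := by
  have hrange : LinearMap.range (restrict V J) = ⊤ := LinearMap.range_eq_top.2 fun f => by
    obtain ⟨v, hv, h⟩ := hI.exists_eqOn fun i => if hi : i ∈ J then f ⟨i, hi⟩ else 0
    exact ⟨⟨v, hv⟩, funext fun i => (h i.1 (hJ i.2)).trans (dif_pos i.2)⟩
  rw [codim_eq_finrank_range, hrange, finrank_top, Module.finrank_fintype_fun_eq_card,
    Fintype.card_coe]

theorem card_inter_le (hI : IsBase V I) (C : Finset (Fin n)) :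
    ((I ∩ C).card : ℚ) ≤ codim V C := by
  rw [← hI.codim_subset Finset.inter_subset_left]
  exact codim_le_codim (intersection_anti Finset.inter_subset_right)

theorem insert_erase (hI : IsBase V I) {w : Fin n → k} (hw : w ∈ V.1) {j l : Fin n} (hj : j ∈ I)
    (hl : l ∉ I) (hw0 : ∀ i ∈ I, i ≠ j → w i = 0) (hwl : w l ≠ 0) :
    IsBase V (insert l (I.erase j)) := by
  refine ⟨?_, fun u hu hu0 => ?_⟩
  · rw [Finset.card_insert_of_notMem fun h => hl (Finset.mem_of_mem_erase h),
      Finset.card_erase_add_one hj, hI.1]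
  have hu0' : ∀ i ∈ I, i ≠ j → u i = 0 := fun i hi hij =>
    hu0 i (Finset.mem_insert_of_mem (Finset.mem_erase.2 ⟨hij, hi⟩))
  have hprop : w j • u = u j • w := by
    refine hI.eq_of_eqOn (V.1.smul_mem _ hu) (V.1.smul_mem _ hw) fun i hi => ?_
    by_cases hij : i = j
    · rw [hij, Pi.smul_apply, Pi.smul_apply, smul_eq_mul, smul_eq_mul, mul_comm]
    · simp [hu0' i hi hij, hw0 i hi hij]
  have huj : u j = 0 := by
    have := congrFun hprop l
    simpa [hu0 l (Finset.mem_insert_self _ _), hwl] using this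
  exact hI.2 u hu fun i hi => if hij : i = j then hij ▸ huj else hu0' i hi hij

theorem exists_exchange (hI : IsBase V I) {v : Fin n → k} (hv : v ∈ V.1) {l : Fin n} (hl : l ∉ I)
    (hvl : v l ≠ 0) : ∃ j ∈ I, v j ≠ 0 ∧ IsBase V (insert l (I.erase j)) := by
  choose w hwV hw using fun j => hI.exists_eqOn (Pi.single j 1)
  have hexpand : v = ∑ j ∈ I, v j • w j := by
    refine hI.eq_of_eqOn hv (V.1.sum_mem fun j _ => V.1.smul_mem _ (hwV j)) fun i hi => ?_
    simp [Finset.sum_apply, hw _ i hi, Pi.single_apply, hi]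
  have hsum : ∑ j ∈ I, v j * w j l ≠ 0 := by
    rw [hexpand, Finset.sum_apply] at hvl
    simpa using hvl
  obtain ⟨j, hj, hne⟩ := Finset.exists_ne_zero_of_sum_ne_zero hsum
  exact ⟨j, hj, left_ne_zero_of_mul hne, hI.insert_erase (hwV j) hj hl
    (fun i hi hij => (hw j i hi).trans (Pi.single_eq_of_ne hij 1)) (right_ne_zero_of_mul hne)⟩

theorem card_inter_eq_codim (hI : IsBase V I) {D : Finset (Fin n)}
    (hD : ∀ l ∈ D, l ∉ I → ∀ j ∈ I, IsBase V (insert l (I.erase j)) → j ∈ D) :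
    ((I ∩ D).card : ℚ) = codim V D := by
  refine le_antisymm (hI.card_inter_le D) ?_
  rw [← hI.codim_subset Finset.inter_subset_left]
  refine codim_le_codim fun v hv => mem_intersection.2 ⟨(mem_intersection.1 hv).1, fun l hl => ?_⟩
  obtain ⟨hvV, hv0⟩ := mem_intersection.1 hv
  by_contra hvl
  have hlI : l ∉ I := fun h => hvl (hv0 l (Finset.mem_inter.2 ⟨h, hl⟩))
  obtain ⟨j, hj, hvj, hbase⟩ := hI.exists_exchange hvV hlI hvl
  exact hvj (hv0 j (Finset.mem_inter.2 ⟨hj, hD l hl hlI j hj hbase⟩))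

end IsBase

end Matroid

section Plucker

variable {k : Type*} [Field k] {r n : ℕ} {V : Gr k r n}

/-- The basis of `V` with respect to which `plucker V` is computed. -/
def basisRows (V : Gr k r n) : Fin r → Fin n → k :=
  fun a => (Module.finBasisOfFinrankEq k V.1 V.2 a : V.1)

theorem span_basisRows (V : Gr k r n) : Submodule.span k (Set.range (basisRows V)) = V.1 := by
  have h : basisRows V = V.1.subtype ∘ Module.finBasisOfFinrankEq k V.1 V.2 := rfl
  rw [h, Set.range_comp, Submodule.span_image, Module.Basis.span_eq, Submodule.map_subtype_top]

theorem exists_minors_eq {w : Fin r → V.1} (hw : LinearIndependent k w) :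
    ∃ c : k, c ≠ 0 ∧ ∀ I, minors (fun a => (w a : Fin n → k)) I = c * plucker V I := by
  let B := Module.finBasisOfFinrankEq k V.1 V.2
  have hunit : IsUnit (B.det w) :=
    B.is_basis_iff_det.1 ⟨hw, hw.span_eq_top_of_card_eq_finrank' (by simp [V.2])⟩
  refine ⟨B.det w, hunit.ne_zero, fun I => ?_⟩
  rw [B.det_apply, ← Matrix.det_transpose, plucker, minors, minors, ← Matrix.det_mul]
  congr 1
  ext a c
  have h := congrArg Subtype.val (B.sum_repr (w a))
  rw [Submodule.coe_sum] at h
  rw [Matrix.of_apply, ← h, Finset.sum_apply]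
  rfl

theorem linearIndependent_comp_basis_iff {ι M N : Type*} [AddCommGroup M] [AddCommGroup N]
    [Module k M] [Module k N] (B : Module.Basis ι k M) (f : M →ₗ[k] N) :
    LinearIndependent k (f ∘ B) ↔ Function.Injective f := by
  have h : ⇑(Finsupp.linearCombination k (f ∘ B)) = f ∘ B.repr.symm := by
    ext c
    rw [Finsupp.linearCombination_linear_comp, LinearMap.comp_apply, Function.comp_apply,
      B.repr_symm_apply]
  rw [LinearIndependent, h]
  exact Function.Injective.of_comp_iff' f B.repr.symm.bijective

theorem plucker_ne_zero_iff (I : PluckerIndex r n) : plucker V I ≠ 0 ↔ IsBase V I.1 := by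
  let f : V.1 →ₗ[k] (Fin r → k) :=
    LinearMap.funLeft k k (I.1.orderEmbOfFin I.2) ∘ₗ V.1.subtype
  have hf : ∀ v, f v = 0 ↔ ∀ i ∈ I.1, (v : Fin n → k) i = 0 := fun v => by
    simp_rw [← Finset.mem_coe, ← Finset.range_orderEmbOfFin I.1 I.2, Set.forall_mem_range]
    exact funext_iff
  rw [← isUnit_iff_ne_zero, plucker, minors, ← Matrix.isUnit_iff_isUnit_det,
    ← Matrix.linearIndependent_rows_iff_isUnit]
  refine (linearIndependent_comp_basis_iff (Module.finBasisOfFinrankEq k V.1 V.2) f).trans ?_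
  simp only [injective_iff_map_eq_zero, hf, IsBase, I.2, true_and, Subtype.forall,
    Submodule.mk_eq_zero]

variable (V) in
theorem exists_plucker_ne_zero : ∃ I, plucker V I ≠ 0 := by
  obtain ⟨I, hI⟩ := exists_isBase V
  exact ⟨⟨I, hI.1⟩, (plucker_ne_zero_iff ⟨I, hI.1⟩).2 hI⟩

/-- The determinant of the columns `f 0, …, f (r-1)` of the matrix with rows `w`, that is, the
Plücker coordinate with index `f` in its alternating form. -/
def columnDet (w : Fin r → Fin n → k) (f : Fin r → Fin n) : k :=
  Matrix.det (Matrix.of fun a c : Fin r => w a (f c))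

theorem exists_columnDet_eq {f : Fin r → Fin n} (hf : Function.Injective f) :
    ∃ (I : PluckerIndex r n) (ε : ℤˣ), ∀ w : Fin r → Fin n → k,
      columnDet w f = ((ε : ℤ) : k) * minors w I := by
  let I : PluckerIndex r n := ⟨Finset.univ.image f, by
    rw [Finset.card_image_of_injective _ hf, Finset.card_fin]⟩
  have hmono : StrictMono (f ∘ Tuple.sort f) :=
    (Tuple.monotone_sort f).strictMono_of_injective (hf.comp (Tuple.sort f).injective)
  have hsort : f ∘ Tuple.sort f = I.1.orderEmbOfFin I.2 :=
    Finset.orderEmbOfFin_unique _ (fun a => Finset.mem_image_of_mem _ (Finset.mem_univ _)) hmono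
  refine ⟨I, Equiv.Perm.sign (Tuple.sort f), fun w => ?_⟩
  have hminors : minors w I =
      ((Matrix.of fun a c : Fin r => w a (f c)).submatrix id (Tuple.sort f)).det := by
    rw [minors, ← hsort]
    rfl
  rw [hminors, Matrix.det_permute', ← mul_assoc, ← Int.cast_mul, Int.units_coe_mul_self,
    Int.cast_one, one_mul, columnDet]

theorem columnDet_eq_of_minors_eq {w w' : Fin r → Fin n → k} {c : k}
    (h : ∀ I, minors w' I = c * minors w I) (f : Fin r → Fin n) :
    columnDet w' f = c * columnDet w f := by
  by_cases hf : Function.Injective f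
  · obtain ⟨I, ε, hε⟩ := exists_columnDet_eq (k := k) hf
    rw [hε, hε, h, mul_left_comm]
  · obtain ⟨a, a', haa, hne⟩ : ∃ a a', f a = f a' ∧ a ≠ a' := by
      simpa [Function.Injective] using hf
    have hzero : ∀ u : Fin r → Fin n → k, columnDet u f = 0 := fun u =>
      Matrix.det_zero_of_column_eq hne fun d => by simp [haa]
    rw [hzero, hzero, mul_zero]

theorem columnDet_mul_apply {w : Fin r → Fin n → k} {v : Fin n → k}
    (hv : v ∈ Submodule.span k (Set.range w)) (f : Fin r → Fin n) (j : Fin n) :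
    columnDet w f * v j = ∑ a, v (f a) * columnDet w (Function.update f a j) := by
  induction hv using Submodule.span_induction with
  | zero => simp
  | add u v _ _ hu hv =>
    simp only [Pi.add_apply, mul_add, add_mul, Finset.sum_add_distrib, hu, hv]
  | smul c v _ hv =>
    simp only [Pi.smul_apply, smul_eq_mul, mul_assoc, ← Finset.mul_sum, ← hv]
    ring
  | mem v hv =>
    obtain ⟨d, rfl⟩ := hv
    have hcramer := congrFun (Matrix.mulVec_cramer (Matrix.of fun a c : Fin r => w a (f c))
      (fun a => w a j)) d
    rw [Matrix.mulVec, dotProduct, Pi.smul_apply, smul_eq_mul] at hcramer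
    rw [columnDet, ← hcramer]
    refine Finset.sum_congr rfl fun a _ => ?_
    rw [Matrix.cramer_apply, Matrix.of_apply, columnDet]
    congr 2
    ext x y
    by_cases hy : y = a
    · subst hy; simp
    · simp [hy]

theorem eq_of_plucker_eq {V' : Gr k r n} {c : k} (h : ∀ I, plucker V' I = c * plucker V I)
    {I : PluckerIndex r n} (hI : plucker V' I ≠ 0) : V' = V := by
  have hIV : plucker V I ≠ 0 := right_ne_zero_of_mul (h I ▸ hI)
  have hle : V'.1 ≤ V.1 := by
    intro v hv
    obtain ⟨u, hu, huv⟩ := ((plucker_ne_zero_iff I).1 hIV).exists_eqOn v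
    have hEq : u = v := by
      let f := I.1.orderEmbOfFin I.2
      have huf : ∀ a, u (f a) = v (f a) := fun a => huv _ (Finset.orderEmbOfFin_mem _ _ _)
      funext j
      apply mul_left_cancel₀ hI
      calc plucker V' I * u j = c * (columnDet (basisRows V) f * u j) := by
            rw [h, mul_assoc]; rfl
        _ = ∑ a, u (f a) * (c * columnDet (basisRows V) (Function.update f a j)) := by
            rw [columnDet_mul_apply (by rwa [span_basisRows]), Finset.mul_sum]
            exact Finset.sum_congr rfl fun a _ => mul_left_comm _ _ _
        _ = ∑ a, v (f a) * columnDet (basisRows V') (Function.update f a j) :=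
            Finset.sum_congr rfl fun a _ => by
              rw [huf, columnDet_eq_of_minors_eq (w := basisRows V) (w' := basisRows V') h]
        _ = plucker V' I * v j :=
            (columnDet_mul_apply (by rwa [span_basisRows]) f j).symm
    exact hEq ▸ hu
  exact Subtype.ext (Submodule.eq_of_le_of_finrank_eq hle (V'.2.trans V.2.symm))

end Plucker

section Polytope

open Topology

variable {k : Type*} [Field k] {r n : ℕ} {V : Gr k r n}

/-- The point of `ℝⁿ` with weight `c I` at the vertex `indicatorPoint I`. -/
def barycenter : (PluckerIndex r n → ℝ) →ₗ[ℝ] (Fin n → ℝ) :=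
  Fintype.linearCombination ℝ indicatorPoint

/-- The convex combinations of the bases of the matroid of `V`. -/
def baseWeights (V : Gr k r n) : Set (PluckerIndex r n → ℝ) :=
  {c ∈ stdSimplex ℝ (PluckerIndex r n) | ∀ I, plucker V I = 0 → c I = 0}

theorem convex_baseWeights : Convex ℝ (baseWeights V) := fun _ hc _ hd s t hs ht hst =>
  ⟨convex_stdSimplex ℝ _ hc.1 hd.1 hs ht hst, fun I hI => by simp [hc.2 I hI, hd.2 I hI]⟩

theorem isBase_of_mem_baseWeights {c : PluckerIndex r n → ℝ} (hc : c ∈ baseWeights V)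
    {I : PluckerIndex r n} (hI : c I ≠ 0) : IsBase V I.1 :=
  (plucker_ne_zero_iff I).1 (mt (hc.2 I) hI)

theorem single_mem_baseWeights {I : PluckerIndex r n} (hI : plucker V I ≠ 0) :
    Pi.single I 1 ∈ baseWeights V :=
  ⟨single_mem_stdSimplex ℝ I, fun J hJ => Pi.single_eq_of_ne (by rintro rfl; exact hI hJ) 1⟩

theorem barycenter_single (I : PluckerIndex r n) :
    barycenter (Pi.single I 1) = indicatorPoint I := by
  rw [barycenter, Fintype.linearCombination_apply_single, one_smul]

theorem matroidPolytope_eq_image : matroidPolytope V = barycenter '' baseWeights V := by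
  refine Set.Subset.antisymm
    (convexHull_min ?_ (convex_baseWeights.linear_image barycenter)) ?_
  · rintro _ ⟨I, hI, rfl⟩
    exact ⟨_, single_mem_baseWeights hI, barycenter_single I⟩
  · rintro _ ⟨c, hc, rfl⟩
    rw [barycenter, Fintype.linearCombination_apply,
      ← Finset.sum_filter_of_ne (p := fun I => c I ≠ 0) fun I _ h => left_ne_zero_of_smul h]
    refine (convex_convexHull ℝ _).sum_mem (fun I _ => hc.1.1 I) ?_ fun I hI =>
      subset_convexHull ℝ _ ⟨I, mt (hc.2 I) (Finset.mem_filter.1 hI).2, rfl⟩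
    rw [Finset.sum_filter_ne_zero, hc.1.2]

theorem barycenter_mem_matroidPolytope {c : PluckerIndex r n → ℝ} (hc : c ∈ baseWeights V) :
    barycenter c ∈ matroidPolytope V :=
  matroidPolytope_eq_image (V := V) ▸ Set.mem_image_of_mem _ hc

theorem sum_barycenter (c : PluckerIndex r n → ℝ) (C : Finset (Fin n)) :
    ∑ i ∈ C, barycenter c i = ∑ I, c I * (I.1 ∩ C).card := by
  simp only [barycenter, Fintype.linearCombination_apply, Finset.sum_apply, Pi.smul_apply,
    smul_eq_mul]
  rw [Finset.sum_comm]
  refine Finset.sum_congr rfl fun I _ => ?_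
  simp [indicatorPoint, Finset.sum_ite_mem, Finset.inter_comm, mul_comm]

theorem mul_card_inter_le {c : PluckerIndex r n → ℝ} (hc : c ∈ baseWeights V)
    (C : Finset (Fin n)) (I : PluckerIndex r n) :
    c I * ((I.1 ∩ C).card : ℝ) ≤ c I * (codim V C : ℝ) := by
  by_cases hI : c I = 0
  · simp [hI]
  · exact mul_le_mul_of_nonneg_left
      (by exact_mod_cast (isBase_of_mem_baseWeights hc hI).card_inter_le C) (hc.1.1 I)

theorem sum_barycenter_le_codim {c : PluckerIndex r n → ℝ} (hc : c ∈ baseWeights V)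
    (C : Finset (Fin n)) : ∑ i ∈ C, barycenter c i ≤ codim V C := by
  rw [sum_barycenter, ← one_mul ((codim V C : ℚ) : ℝ), ← hc.1.2, Finset.sum_mul]
  exact Finset.sum_le_sum fun I _ => mul_card_inter_le hc C I

theorem card_inter_eq_codim_of_le_sum_barycenter {c : PluckerIndex r n → ℝ}
    (hc : c ∈ baseWeights V) {C : Finset (Fin n)} (h : (codim V C : ℝ) ≤ ∑ i ∈ C, barycenter c i)
    {I : PluckerIndex r n} (hI : c I ≠ 0) : ((I.1 ∩ C).card : ℚ) = codim V C := by
  have hsum : ∑ J, c J * ((J.1 ∩ C).card : ℝ) = ∑ J, c J * (codim V C : ℝ) := by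
    refine le_antisymm (Finset.sum_le_sum fun J _ => mul_card_inter_le hc C J) ?_
    rwa [← Finset.sum_mul, hc.1.2, one_mul, ← sum_barycenter]
  have hI' := (Finset.sum_eq_sum_iff_of_le fun J _ => mul_card_inter_le hc C J).1 hsum I
    (Finset.mem_univ I)
  exact_mod_cast mul_left_cancel₀ hI hI'

theorem sum_barycenter_eq_codim {c : PluckerIndex r n → ℝ} (hc : c ∈ baseWeights V)
    {C : Finset (Fin n)} (hC : ∀ I : PluckerIndex r n, c I ≠ 0 → ∀ l ∈ C, l ∉ I.1 → ∀ j ∈ I.1,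
      IsBase V (insert l (I.1.erase j)) → j ∈ C) :
    ∑ i ∈ C, barycenter c i = codim V C := by
  rw [sum_barycenter, ← one_mul ((codim V C : ℚ) : ℝ), ← hc.1.2, Finset.sum_mul]
  refine Finset.sum_congr rfl fun I _ => ?_
  by_cases hI : c I = 0
  · simp [hI]
  · congr 1
    exact_mod_cast (isBase_of_mem_baseWeights hc hI).card_inter_eq_codim (hC I hI)

theorem sum_le_codim {y : Fin n → ℝ} (hy : y ∈ matroidPolytope V) (C : Finset (Fin n)) :
    ∑ i ∈ C, y i ≤ codim V C := by
  rw [matroidPolytope_eq_image] at hy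
  obtain ⟨c, hc, rfl⟩ := hy
  exact sum_barycenter_le_codim hc C

theorem nonneg_of_mem_matroidPolytope {y : Fin n → ℝ} (hy : y ∈ matroidPolytope V) (i : Fin n) :
    0 ≤ y i := by
  rw [matroidPolytope_eq_image] at hy
  obtain ⟨c, hc, rfl⟩ := hy
  rw [← Finset.sum_singleton (barycenter c), sum_barycenter]
  exact Finset.sum_nonneg fun I _ => mul_nonneg (hc.1.1 I) (Nat.cast_nonneg _)

theorem sum_eq_of_mem_matroidPolytope {y : Fin n → ℝ} (hy : y ∈ matroidPolytope V) :
    ∑ i, y i = r := by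
  rw [matroidPolytope_eq_image] at hy
  obtain ⟨c, hc, rfl⟩ := hy
  rw [sum_barycenter, ← one_mul (r : ℝ), ← hc.1.2, Finset.sum_mul]
  exact Finset.sum_congr rfl fun I _ => by rw [Finset.inter_univ, I.2]

theorem isCompact_matroidPolytope (V : Gr k r n) : IsCompact (matroidPolytope V) := by
  refine Set.Finite.isCompact_convexHull ℝ ((Set.finite_range (indicatorPoint (r := r))).subset ?_)
  rintro _ ⟨I, -, rfl⟩
  exact ⟨I, rfl⟩

/-- At the point `y` of the matroid polytope, the coordinate `i` can be increased at the expense of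
the coordinate `j`. -/
def CanTransfer (V : Gr k r n) (y : Fin n → ℝ) (i j : Fin n) : Prop :=
  ∃ ε : ℝ, 0 < ε ∧ y + ε • (Pi.single i 1 - Pi.single j 1) ∈ matroidPolytope V

theorem CanTransfer.trans {y : Fin n → ℝ} {i j l : Fin n} (hij : CanTransfer V y i j)
    (hjl : CanTransfer V y j l) : CanTransfer V y i l := by
  obtain ⟨ε, hε, hij⟩ := hij
  obtain ⟨δ, hδ, hjl⟩ := hjl
  refine ⟨ε * δ / (ε + δ), by positivity, ?_⟩
  convert! convex_convexHull ℝ _ hij hjl (a := δ / (ε + δ)) (b := ε / (ε + δ)) (by positivity)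
    (by positivity) (by field_simp; ring) using 1
  funext m
  simp only [Pi.add_apply, Pi.smul_apply, Pi.sub_apply, smul_eq_mul]
  field_simp
  ring

theorem CanTransfer.exists_le {y b : Fin n → ℝ} {i j : Fin n} (h : CanTransfer V y i j)
    (hy : y ∈ matroidPolytope V) (hyb : y ≤ b) (hi : y i < b i) :
    ∃ δ : ℝ, 0 < δ ∧ y + δ • (Pi.single i 1 - Pi.single j 1) ∈ matroidPolytope V ∧
      y + δ • (Pi.single i 1 - Pi.single j 1) ≤ b := by
  obtain ⟨ε, hε, hmem⟩ := h
  have hδ : 0 < min ε (b i - y i) := lt_min hε (sub_pos.2 hi)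
  refine ⟨min ε (b i - y i), hδ, ?_, fun m => ?_⟩
  · have := (convex_convexHull ℝ _).add_smul_mem hy hmem (t := min ε (b i - y i) / ε)
      ⟨by positivity, (div_le_one hε).2 (min_le_left _ _)⟩
    rwa [smul_smul, div_mul_cancel₀ _ hε.ne'] at this
  · have hle : min ε (b i - y i) ≤ b i - y i := min_le_right _ _
    have hm := hyb m
    simp only [Pi.add_apply, Pi.smul_apply, Pi.sub_apply, smul_eq_mul, Pi.single_apply]
    split_ifs with h1 h2 h2 <;> (try subst h1) <;> linarith

theorem indicatorPoint_exchange {I : PluckerIndex r n} {l j : Fin n} (hl : l ∉ I.1) (hj : j ∈ I.1)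
    (hcard : (insert l (I.1.erase j)).card = r) :
    indicatorPoint ⟨insert l (I.1.erase j), hcard⟩ =
      indicatorPoint I + (Pi.single l 1 - Pi.single j 1) := by
  have hlj : l ≠ j := by rintro rfl; exact hl hj
  funext i
  simp only [Pi.add_apply, Pi.sub_apply, Pi.single_apply, indicatorPoint, Finset.mem_insert,
    Finset.mem_erase]
  by_cases hil : i = l
  · subst hil; simp [hl, hlj]
  · by_cases hij : i = j
    · subst hij; simp [hil, hj]
    · simp [hil, hij]

theorem canTransfer_of_exchange {c : PluckerIndex r n → ℝ} (hc : c ∈ baseWeights V)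
    {I : PluckerIndex r n} (hI : c I ≠ 0) {l j : Fin n} (hl : l ∉ I.1) (hj : j ∈ I.1)
    (hbase : IsBase V (insert l (I.1.erase j))) : CanTransfer V (barycenter c) l j := by
  let J : PluckerIndex r n := ⟨insert l (I.1.erase j), hbase.1⟩
  have hcI : 0 ≤ c I := hc.1.1 I
  refine ⟨c I, hcI.lt_of_ne' hI, ?_⟩
  rw [matroidPolytope_eq_image]
  refine ⟨c - c I • Pi.single I 1 + c I • Pi.single J 1, ⟨⟨fun M => ?_, ?_⟩, fun M hM => ?_⟩, ?_⟩
  · have hM := hc.1.1 M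
    simp only [Pi.add_apply, Pi.sub_apply, Pi.smul_apply, Pi.single_apply, smul_eq_mul]
    split_ifs with h1 h2 h2 <;> (try subst h1) <;> linarith
  · simp [Finset.sum_add_distrib, Finset.sum_sub_distrib, ← Finset.mul_sum, hc.1.2]
  · have hMI : M ≠ I := by rintro rfl; exact hI (hc.2 _ hM)
    have hMJ : M ≠ J := by rintro rfl; exact (plucker_ne_zero_iff J).2 hbase hM
    simp [hMI, hMJ, hc.2 M hM]
  · rw [map_add, map_sub, map_smul, map_smul, barycenter_single, barycenter_single,
      indicatorPoint_exchange hl hj]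
    module

open Classical in
theorem sum_canTransfer_eq_codim {y : Fin n → ℝ} (hy : y ∈ matroidPolytope V) (i : Fin n) :
    ∑ j with CanTransfer V y i j, y j = codim V {j | CanTransfer V y i j} := by
  rw [matroidPolytope_eq_image] at hy
  obtain ⟨c, hc, rfl⟩ := hy
  refine sum_barycenter_eq_codim hc fun I hI l hl hlI j hj hbase => ?_
  rw [Finset.mem_filter_univ] at hl ⊢
  exact hl.trans (canTransfer_of_exchange hc hI hlI hj hbase)

theorem exists_le_and_eqOn {b : Fin n → ℝ} {Z : Finset (Fin n)}
    (hne : (matroidPolytope V ∩ Set.Iic b).Nonempty)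
    (hZ : ∀ C ⊆ Z, C.Nonempty → ∑ i ∈ C, b i ≤ codim V C) :
    ∃ y ∈ matroidPolytope V, y ≤ b ∧ ∀ i ∈ Z, y i = b i := by
  classical
  obtain ⟨y, ⟨hyP, hyb : y ≤ b⟩, hmax⟩ := ((isCompact_matroidPolytope V).inter_right
    isClosed_Iic).exists_isMaxOn hne
      (f := fun y => ∑ i ∈ Z, y i) (Continuous.continuousOn (by fun_prop))
  refine ⟨y, hyP, hyb, fun i hi => (hyb i).eq_of_not_lt fun hlt => ?_⟩
  let C : Finset (Fin n) := {j | CanTransfer V y i j}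
  have hiC : i ∈ C := Finset.mem_filter_univ _ |>.2 ⟨1, one_pos, by simpa using hyP⟩
  have hCZ : C ⊆ Z := fun j hj => by
    obtain ⟨δ, hδ, hmem, hle⟩ := (Finset.mem_filter_univ _ |>.1 hj).exists_le hyP hyb hlt
    by_contra hjZ
    have hle := hmax ⟨hmem, hle⟩
    simp only [Pi.add_apply, Pi.smul_apply, Pi.sub_apply, smul_eq_mul, Finset.sum_add_distrib,
      ← Finset.mul_sum, Finset.sum_sub_distrib, Set.mem_ofPred_eq, Finset.sum_pi_single', if_pos hi,
      if_neg hjZ] at hle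
    linarith
  refine (hZ C hCZ ⟨i, hiC⟩).not_gt ?_
  rw [← sum_canTransfer_eq_codim hyP]
  exact Finset.sum_lt_sum (fun m _ => hyb m) ⟨i, hiC, hlt⟩

/-- The convex combinations of the bases of the matroid of `V` in which every base has positive
weight. -/
def fullBaseWeights (V : Gr k r n) : Set (PluckerIndex r n → ℝ) :=
  {c ∈ stdSimplex ℝ (PluckerIndex r n) | ∀ I, c I = 0 ↔ plucker V I = 0}

theorem fullBaseWeights_subset : fullBaseWeights V ⊆ baseWeights V :=
  fun _ hc => ⟨hc.1, fun I => (hc.2 I).2⟩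

theorem add_mem_fullBaseWeights {c e : PluckerIndex r n → ℝ} (hc : c ∈ baseWeights V)
    (he : e ∈ fullBaseWeights V) {s t : ℝ} (hs : 0 ≤ s) (ht : 0 < t) (hst : s + t = 1) :
    s • c + t • e ∈ fullBaseWeights V := by
  refine ⟨convex_stdSimplex ℝ _ hc.1 he.1 hs ht.le hst,
    fun I => ⟨fun h => (he.2 I).1 ?_, fun h => ?_⟩⟩
  · have hcI := mul_nonneg hs (hc.1.1 I)
    have heI := mul_nonneg ht.le (he.1.1 I)
    simp only [Pi.add_apply, Pi.smul_apply, smul_eq_mul] at h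
    exact (mul_eq_zero.1 (by linarith)).resolve_left ht.ne'
  · simp [hc.2 I h, (he.2 I).2 h]

variable (V) in
theorem fullBaseWeights_nonempty : (fullBaseWeights V).Nonempty := by
  classical
  let S : Finset (PluckerIndex r n) := {I | plucker V I ≠ 0}
  have hS : S.Nonempty := by
    obtain ⟨I, hI⟩ := exists_plucker_ne_zero V
    exact ⟨I, (Finset.mem_filter_univ _).2 hI⟩
  have hcard : (S.card : ℝ) ≠ 0 := Nat.cast_ne_zero.2 hS.card_ne_zero
  refine ⟨fun I => if I ∈ S then (S.card : ℝ)⁻¹ else 0, ⟨fun I => ?_, ?_⟩, fun I => ?_⟩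
  · dsimp only
    split_ifs <;> positivity
  · simp [Finset.sum_ite_mem, hcard]
  · simp [hcard, S]

theorem exists_fullBaseWeights_lt {b y : Fin n → ℝ} (hy : y ∈ matroidPolytope V)
    (hyb : ∀ i, y i < b i) : ∃ c ∈ fullBaseWeights V, ∀ i, barycenter c i < b i := by
  rw [matroidPolytope_eq_image] at hy
  obtain ⟨c, hc, rfl⟩ := hy
  obtain ⟨e, he⟩ := fullBaseWeights_nonempty V
  have hev : ∀ᶠ t in 𝓝[>] (0 : ℝ), ∀ i, barycenter ((1 - t) • c + t • e) i < b i := by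
    refine Filter.eventually_all.2 fun i => (ContinuousAt.eventually_lt ?_ continuousAt_const
      (by simpa using hyb i)).filter_mono nhdsWithin_le_nhds
    simp only [map_add, map_smul]
    fun_prop
  obtain ⟨t, hlt, ht⟩ := (hev.and (Ioo_mem_nhdsGT one_pos)).exists
  exact ⟨_, add_mem_fullBaseWeights hc he (sub_nonneg.2 ht.2.le) ht.1 (sub_add_cancel 1 t), hlt⟩

theorem exists_overshoot {b z : Fin n → ℝ} {Z : Finset (Fin n)} (hz : z ∈ matroidPolytope V)
    (hzb : ∀ i, z i < b i) (hZ : ∀ C ⊆ Z, C.Nonempty → ∑ i ∈ C, b i < codim V C) :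
    ∃ δ : ℝ, 0 < δ ∧ ∃ y ∈ matroidPolytope V,
      (∀ i ∈ Z, y i = b i + δ * (b i - z i)) ∧ ∀ i ∉ Z, y i ≤ z i := by
  classical
  have hev : ∀ᶠ δ in 𝓝[>] (0 : ℝ), ∀ C ∈ Z.powerset, C.Nonempty →
      ∑ i ∈ C, (b i + δ * (b i - z i)) < codim V C := by
    refine (Filter.eventually_all_finset _).2 fun C hC => Filter.eventually_imp_distrib_left.2
      fun hCne => (ContinuousAt.eventually_lt (by fun_prop) continuousAt_const ?_).filter_mono
        nhdsWithin_le_nhds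
    simpa using hZ C (Finset.mem_powerset.1 hC) hCne
  obtain ⟨δ, hδZ, hδ : 0 < δ⟩ := (hev.and self_mem_nhdsWithin).exists
  have hzle : z ≤ Z.piecewise (fun i => b i + δ * (b i - z i)) z :=
    Finset.le_piecewise_of_le_of_le _ (fun i => by nlinarith [hzb i]) le_rfl
  obtain ⟨y, hy, hle, heq⟩ := exists_le_and_eqOn (Z := Z) ⟨z, hz, hzle⟩ fun C hC hCne => by
    refine (Finset.sum_congr rfl fun i hi => ?_).trans_le
      (hδZ C (Finset.mem_powerset.2 hC) hCne).le
    exact Finset.piecewise_eq_of_mem _ _ _ (hC hi)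
  exact ⟨δ, hδ, y, hy, fun i hi => (heq i hi).trans (Finset.piecewise_eq_of_mem _ _ _ hi),
    fun i hi => (hle i).trans_eq (Finset.piecewise_eq_of_notMem _ _ _ hi)⟩

theorem exists_fullBaseWeights_eqOn {b : Fin n → ℝ} {Z : Finset (Fin n)}
    (hne : ∃ y ∈ matroidPolytope V, ∀ i, y i < b i)
    (hZ : ∀ C ⊆ Z, C.Nonempty → ∑ i ∈ C, b i < codim V C) :
    ∃ c ∈ fullBaseWeights V, (∀ i ∈ Z, barycenter c i = b i) ∧ ∀ i ∉ Z, barycenter c i < b i := by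
  obtain ⟨y, hy, hyb⟩ := hne
  obtain ⟨e, he, heb⟩ := exists_fullBaseWeights_lt hy hyb
  -- Overshooting `b` on `Z` leaves room for mixing in the full combination `e`.
  obtain ⟨δ, hδ, _, hmem, heq, hle⟩ := exists_overshoot
    (barycenter_mem_matroidPolytope (fullBaseWeights_subset he)) heb hZ
  rw [matroidPolytope_eq_image] at hmem
  obtain ⟨d, hd, rfl⟩ := hmem
  refine ⟨(1 / (1 + δ)) • d + (δ / (1 + δ)) • e, add_mem_fullBaseWeights hd he (by positivity)
    (by positivity) (by field_simp), fun i hi => ?_, fun i hi => ?_⟩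
  all_goals simp only [map_add, map_smul, Pi.add_apply, Pi.smul_apply, smul_eq_mul]
  · rw [heq i hi]
    field_simp
    ring
  · rw [div_mul_eq_mul_div, div_mul_eq_mul_div, ← add_div, div_lt_iff₀ (by positivity)]
    nlinarith [heb i, hle i hi]

theorem exists_one_lt_lineMap_mem {E : Type*} [NormedAddCommGroup E] [NormedSpace ℝ E] {S : Set E}
    {y z : E} (hy : y ∈ intrinsicInterior ℝ S) (hz : z ∈ S) :
    ∃ t : ℝ, 1 < t ∧ AffineMap.lineMap z y t ∈ S := by
  obtain ⟨y', hy', rfl⟩ := mem_intrinsicInterior.1 hy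
  let γ : ℝ → affineSpan ℝ S := fun t =>
    ⟨AffineMap.lineMap z (y' : E) t, AffineMap.lineMap_mem t (subset_affineSpan ℝ _ hz) y'.2⟩
  have hγ : Continuous γ := AffineMap.lineMap_continuous.subtype_mk _
  have hγ1 : γ 1 = y' := Subtype.ext (AffineMap.lineMap_apply_one _ _)
  have hev : ∀ᶠ t in 𝓝[>] (1 : ℝ), γ t ∈ Subtype.val ⁻¹' S :=
    (hγ.continuousAt.eventually_mem (hγ1.symm ▸ mem_interior_iff_mem_nhds.1 hy')).filter_mono
      nhdsWithin_le_nhds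
  obtain ⟨t, hmem, ht⟩ := (hev.and self_mem_nhdsWithin).exists
  exact ⟨t, ht, hmem⟩

theorem lt_of_mem_intrinsicInterior {b : Fin n → ℚ} (hb : ∀ i, 0 < b i) (hr : (r : ℚ) < ∑ i, b i)
    {y : Fin n → ℝ} (hy : y ∈ intrinsicInterior ℝ (weightedHypersimplex r b)) (i : Fin n) :
    y i < b i := by
  let q : ℚ := r / ∑ i, b i
  have hsum : 0 < ∑ i, b i := r.cast_nonneg.trans_lt hr
  have hz : ∀ i, q * b i < b i := fun i =>
    mul_lt_of_lt_one_left (hb i) ((div_lt_one hsum).2 hr)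
  have hzmem : (fun i => ((q * b i : ℚ) : ℝ)) ∈ weightedHypersimplex r b := by
    refine ⟨fun i => ⟨?_, Rat.cast_le.2 (hz i).le⟩, ?_⟩
    · have := hb i
      exact Rat.cast_nonneg.2 (by positivity)
    · rw [← Rat.cast_sum, ← Finset.mul_sum, div_mul_cancel₀ _ hsum.ne', Rat.cast_natCast]
  obtain ⟨t, ht, hmem⟩ := exists_one_lt_lineMap_mem hy hzmem
  have hle := (hmem.1 i).2
  have hzi : ((q * b i : ℚ) : ℝ) < b i := by exact_mod_cast hz i
  rw [AffineMap.lineMap_apply_module', Pi.add_apply, Pi.smul_apply, Pi.sub_apply,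
    smul_eq_mul] at hle
  nlinarith

end Polytope

section Coordinates

variable {k : Type*} [Field k] {r n : ℕ} {G : Type*} [CommGroup G]

theorem weight_eq_sum {M : Type*} [AddCommMonoid M] (w : Coord r n → M) (u : Coord r n →₀ ℕ) :
    Finsupp.weight w u = ∑ j, u j • w j := by
  rw [Finsupp.weight_apply, Finsupp.sum_fintype _ _ fun i => zero_smul ℕ (w i)]

theorem weight_character_apply (u : Coord r n →₀ ℕ) (i : Fin n) :
    Finsupp.weight (character r n) u i =
      u (Sum.inl i) + ∑ I : PluckerIndex r n with i ∈ I.1, u (Sum.inr I) := by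
  rw [weight_eq_sum, Finset.sum_apply, Fintype.sum_sum_type]
  simp [character, Finset.sum_filter]

theorem weight_bidegree_snd (u : Coord r n →₀ ℕ) :
    (Finsupp.weight (bidegree r n) u).2 = ∑ I, u (Sum.inr I) := by
  rw [weight_eq_sum, Prod.snd_sum, Fintype.sum_sum_type]
  simp [bidegree]

theorem sum_character (j : Coord r n) :
    ∑ i, character r n j i = (bidegree r n j).1 + r * (bidegree r n j).2 := by
  rcases j with i | I
  · simp [character, bidegree]
  · simp [character, bidegree, I.2]

theorem sum_weight_character (u : Coord r n →₀ ℕ) :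
    ∑ i, Finsupp.weight (character r n) u i =
      (Finsupp.weight (bidegree r n) u).1 + r * (Finsupp.weight (bidegree r n) u).2 := by
  simp only [weight_eq_sum, Finset.sum_apply, Pi.smul_apply, Prod.fst_sum, Prod.snd_sum,
    Prod.smul_fst, Prod.smul_snd, smul_eq_mul]
  rw [Finset.sum_comm, Finset.mul_sum, ← Finset.sum_add_distrib]
  refine Finset.sum_congr rfl fun j _ => ?_
  rw [← Finset.mul_sum, sum_character]
  ring

/-- The factors by which `(t, ν)` multiplies the coordinates: `t` acts through the characters and
`ν` rescales the Plücker coordinates. A rescaling of the `z i` is the action of a constant `t`. -/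
def scale : (Fin n → G) × G →* (Coord r n → G) where
  toFun g := Sum.elim g.1 fun I => (∏ i ∈ I.1, g.1 i) * g.2
  map_one' := by ext (i | I) <;> simp
  map_mul' g h := by ext (i | I) <;> simp [Finset.prod_mul_distrib, mul_mul_mul_comm]

@[simp] theorem scale_inl (g : (Fin n → G) × G) (i : Fin n) :
    scale (r := r) g (Sum.inl i) = g.1 i := rfl

@[simp] theorem scale_inr (g : (Fin n → G) × G) (I : PluckerIndex r n) :
    scale g (Sum.inr I) = (∏ i ∈ I.1, g.1 i) * g.2 := rfl

theorem scale_apply (g : (Fin n → G) × G) (j : Coord r n) :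
    scale g j = (∏ i, g.1 i ^ character r n j i) * g.2 ^ (bidegree r n j).2 := by
  rcases j with i | I
  · simp [character, bidegree, pow_ite]
  · simp [character, bidegree, pow_ite, Finset.prod_ite_mem]

theorem prod_scale_pow (g : (Fin n → G) × G) (u : Coord r n →₀ ℕ) :
    ∏ j, scale g j ^ u j = (∏ i, g.1 i ^ Finsupp.weight (character r n) u i) *
      g.2 ^ (Finsupp.weight (bidegree r n) u).2 := by
  simp only [scale_apply, mul_pow, Finset.prod_mul_distrib, weight_eq_sum, Finset.sum_apply,
    Prod.snd_sum, ← Finset.prod_pow_eq_pow_sum, ← Finset.prod_pow]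
  rw [Finset.prod_comm]
  simp only [← pow_mul, Pi.smul_apply, Prod.smul_snd, smul_eq_mul, mul_comm]

theorem rep_mem (x : UniversalFamily k r n) : x.point.rep ∈ x.space.1 := by
  have := x.point_mem
  rwa [Projectivization.submodule_eq, Submodule.span_singleton_le_iff_mem] at this

/-- `z` is a system of homogeneous coordinates of `x`. -/
def IsHomogeneousCoord (x : UniversalFamily k r n) (z : Coord r n → k) : Prop :=
  ∃ μ ν : kˣ, ∀ j, z j = scale (fun _ => μ, ν) j * x.coord j

theorem isHomogeneousCoord {x : UniversalFamily k r n} {v : Fin n → k}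
    (hv : v ∈ x.point.submodule) (hv0 : v ≠ 0) {w : Fin r → x.space.1}
    (hw : LinearIndependent k w) :
    IsHomogeneousCoord x (Sum.elim v (minors fun a => (w a : Fin n → k))) := by
  rw [Projectivization.submodule_eq, Submodule.mem_span_singleton] at hv
  obtain ⟨μ, rfl⟩ := hv
  obtain ⟨c, hc, hwc⟩ := exists_minors_eq hw
  have hμ : μ ≠ 0 := left_ne_zero_of_smul hv0
  refine ⟨Units.mk0 μ hμ, Units.mk0 (c / μ ^ r) (div_ne_zero hc (pow_ne_zero _ hμ)), ?_⟩
  rintro (i | I)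
  · rfl
  · simp [hwc, UniversalFamily.coord, I.2, mul_div_cancel₀, hμ]

theorem aeval_scale_mul {F : MvPolynomial (Coord r n) k} {d : ℕ × ℕ}
    (hF : MvPolynomial.IsWeightedHomogeneous (bidegree r n) F d) (μ ν : kˣ) (c : Coord r n → k) :
    MvPolynomial.aeval (fun j => (scale (fun _ => μ, ν) j : kˣ) * c j) F =
      (μ ^ (d.1 + r * d.2) * ν ^ d.2 : kˣ) * MvPolynomial.aeval c F := by
  rw [MvPolynomial.aeval_def, MvPolynomial.aeval_def, MvPolynomial.eval₂_eq',
    MvPolynomial.eval₂_eq', Finset.mul_sum]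
  refine Finset.sum_congr rfl fun u hu => ?_
  have hscale := prod_scale_pow ((fun _ : Fin n => μ), ν) u
  rw [Finset.prod_pow_eq_pow_sum, sum_weight_character,
    hF (MvPolynomial.mem_support_iff.1 hu)] at hscale
  simp only [mul_pow, Finset.prod_mul_distrib]
  rw [← hscale, Units.coe_prod, mul_left_comm]
  simp only [Units.val_pow_eq_pow_val]

theorem IsHomogeneousCoord.aeval_ne_zero_iff {x : UniversalFamily k r n} {z : Coord r n → k}
    (hz : IsHomogeneousCoord x z) {F : MvPolynomial (Coord r n) k} {d : ℕ × ℕ}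
    (hF : MvPolynomial.IsWeightedHomogeneous (bidegree r n) F d) :
    MvPolynomial.aeval z F ≠ 0 ↔ MvPolynomial.aeval x.coord F ≠ 0 := by
  obtain ⟨μ, ν, h⟩ := hz
  rw [funext h, aeval_scale_mul hF, ne_eq, Units.mul_right_eq_zero]

theorem minors_smul (t : Fin n → kˣ) (w : Fin r → Fin n → k) (I : PluckerIndex r n) :
    minors (fun a => t • w a) I = ((∏ i ∈ I.1, t i : kˣ) : k) * minors w I := by
  have hprod : ((∏ i ∈ I.1, t i : kˣ) : k) = ∏ c, (t (I.1.orderEmbOfFin I.2 c) : k) := by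
    conv_lhs => rw [← Finset.map_orderEmbOfFin_univ I.1 I.2]
    rw [Finset.prod_map, Units.coe_prod]
    rfl
  rw [hprod, minors, minors, ← Matrix.det_mul_row]
  rfl

theorem linearIndependent_basisRows (V : Gr k r n) : LinearIndependent k (basisRows V) :=
  (Module.finBasisOfFinrankEq k V.1 V.2).linearIndependent.map' V.1.subtype V.1.ker_subtype

theorem smul_rep_mem (t : Fin n → kˣ) (x : UniversalFamily k r n) :
    t • x.point.rep ∈ (t • x).point.submodule := by
  have hpoint : (t • x).point = Projectivization.mk k (t • x.point.rep)
      ((smul_ne_zero_iff_ne t).2 x.point.rep_nonzero) := by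
    rw [← Projectivization.smul_mk _ x.point.rep_nonzero, Projectivization.mk_rep]
    rfl
  rw [hpoint, Projectivization.submodule_mk]
  exact Submodule.mem_span_singleton_self _

theorem coord_smul (t : Fin n → kˣ) (x : UniversalFamily k r n) :
    ∃ μ ν : kˣ, ∀ j, (t • x).coord j = scale ((fun _ => μ) * t, ν) j * x.coord j := by
  let w : Fin r → (t • x).space.1 := fun a =>
    ⟨t • basisRows x.space a, Submodule.smul_mem_pointwise_smul _ t _ (Subtype.prop _)⟩
  have hw : LinearIndependent k w := .of_comp (t • x).space.1.subtype <|
    (linearIndependent_basisRows x.space).map'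
      (DistribMulAction.toLinearEquiv k (Fin n → k) t).toLinearMap (LinearEquiv.ker _)
  obtain ⟨μ, ν, h⟩ := isHomogeneousCoord (smul_rep_mem t x)
    ((smul_ne_zero_iff_ne t).2 x.point.rep_nonzero) hw
  have hsmul : ∀ j, Sum.elim (t • x.point.rep) (minors fun a => (w a : Fin n → k)) j =
      scale (t, 1) j * x.coord j := by
    rintro (i | I)
    · rfl
    · exact (minors_smul t _ I).trans (by rw [scale_inr, mul_one]; rfl)
  refine ⟨μ⁻¹, ν⁻¹, fun j => ?_⟩
  have hg : (((fun _ => μ⁻¹) * t, ν⁻¹) : (Fin n → kˣ) × kˣ) = (fun _ => μ, ν)⁻¹ * (t, 1) :=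
    Prod.ext rfl (mul_one _).symm
  rw [hg, map_mul, map_inv, Pi.mul_apply, Pi.inv_apply, Units.val_mul, mul_assoc, ← hsmul, h,
    Units.inv_mul_cancel_left]

theorem IsHomogeneousCoord.eq {x y : UniversalFamily k r n} (hxy : IsHomogeneousCoord x y.coord) :
    y = x := by
  obtain ⟨μ, ν, h⟩ := hxy
  obtain ⟨I, hI⟩ := exists_plucker_ne_zero y.space
  refine UniversalFamily.ext ?_ (eq_of_plucker_eq (c := (μ ^ r * ν : kˣ)) (fun I => ?_) hI)
  · rw [← y.point.mk_rep, ← x.point.mk_rep, Projectivization.mk_eq_mk_iff']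
    exact ⟨μ, (funext fun i => h (Sum.inl i)).symm⟩
  · simpa [UniversalFamily.coord, I.2] using h (Sum.inr I)

theorem eq_smul_of_coord_eq {x y : UniversalFamily k r n} {g : (Fin n → kˣ) × kˣ}
    (h : ∀ j, y.coord j = scale g j * x.coord j) : y = g.1 • x := by
  obtain ⟨μ, ν, hx⟩ := coord_smul g.1 x
  refine IsHomogeneousCoord.eq ⟨μ⁻¹, g.2 / ν, fun j => ?_⟩
  have hg : ((fun _ => μ⁻¹, g.2 / ν) : (Fin n → kˣ) × kˣ) = g * ((fun _ => μ) * g.1, ν)⁻¹ := by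
    ext <;> simp [div_eq_mul_inv]
  rw [h, hx, hg, map_mul, map_inv, Pi.mul_apply, Pi.inv_apply, Units.val_mul, mul_assoc,
    Units.inv_mul_cancel_left]

end Coordinates

section Semistable

variable {k : Type*} [Field k] {r n : ℕ} {b : Fin n → ℚ} {N : ℕ} {u : Coord r n →₀ ℕ}

/-- `u` is the exponent of a monomial in the coordinates that represents an invariant section of the
`N`-th power of the polarization. -/
def IsInvariantExponent (b : Fin n → ℚ) (N : ℕ) (u : Coord r n →₀ ℕ) : Prop :=
  (∀ i, (Finsupp.weight (character r n) u i : ℚ) = N * b i) ∧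
    (Finsupp.weight (bidegree r n) u).2 = N

theorem IsInvariantExponent.bidegree_fst (hu : IsInvariantExponent b N u) :
    ((Finsupp.weight (bidegree r n) u).1 : ℚ) = N * (∑ i, b i - r) := by
  have h := congrArg (Nat.cast : ℕ → ℚ) (sum_weight_character u)
  rw [hu.2, Nat.cast_sum, Finset.sum_congr rfl fun i _ => hu.1 i, ← Finset.mul_sum] at h
  push_cast at h
  linarith

theorem isSemistable_iff_exists_exponent {A : Type*} [CommRing A] [Algebra A k]
    {x : UniversalFamily k r n} : IsSemistable A b x ↔ ∃ (N : ℕ) (u : Coord r n →₀ ℕ), 0 < N ∧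
      IsInvariantExponent b N u ∧ ∀ j, x.coord j = 0 → u j = 0 := by
  constructor
  · rintro ⟨N, s, hN, ⟨a, c, -, hc, hdeg, hchar⟩, hs⟩
    rw [MvPolynomial.aeval_def, MvPolynomial.eval₂_eq'] at hs
    obtain ⟨u, hu, hne⟩ := Finset.exists_ne_zero_of_sum_ne_zero hs
    rw [MvPolynomial.mem_support_iff] at hu
    refine ⟨N, u, hN, ⟨fun i => by rw [hchar hu, hc], by rw [hdeg hu]⟩, fun j hj => ?_⟩
    by_contra huj
    exact right_ne_zero_of_mul hne
      (Finset.prod_eq_zero (Finset.mem_univ j) (by rw [hj, zero_pow huj]))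
  · rintro ⟨N, u, hN, hu, hsupp⟩
    refine ⟨N, MvPolynomial.monomial u 1, hN, ⟨_, _, hu.bidegree_fst, hu.1,
      MvPolynomial.isWeightedHomogeneous_monomial _ _ _ (Prod.ext rfl hu.2),
      MvPolynomial.isWeightedHomogeneous_monomial _ _ _ rfl⟩, ?_⟩
    rw [MvPolynomial.aeval_monomial, map_one, one_mul]
    exact Finset.prod_ne_zero_iff.2 fun j hj =>
      pow_ne_zero _ (mt (hsupp j) (Finsupp.mem_support_iff.1 hj))

/- The basis coordinates of the elements of `ρ` are perturbed to rational numbers, which keeps the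
finitely many strict inequalities. -/
theorem exists_ratLinearMap_pos {ι : Type*} [Finite ι] {ρ : ι → ℝ} (hρ : ∀ j, 0 < ρ j) :
    ∃ φ : ℝ →ₗ[ℚ] ℚ, ∀ j, 0 < φ (ρ j) := by
  let B := Module.Basis.ofVectorSpace ℚ ℝ
  let f : ι → (Module.Basis.ofVectorSpaceIndex ℚ ℝ → ℝ) → ℝ := fun j s =>
    ∑ a ∈ (B.repr (ρ j)).support, B.repr (ρ j) a * s a
  have hopen : IsOpen (⋂ j, f j ⁻¹' Set.Ioi 0) :=
    isOpen_iInter_of_finite fun j => isOpen_Ioi.preimage (by fun_prop)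
  have hmem : (fun a => B a) ∈ ⋂ j, f j ⁻¹' Set.Ioi 0 := Set.mem_iInter.2 fun j => by
    have hf : f j (fun a => B a) = ρ j := by
      conv_rhs => rw [← B.linearCombination_repr (ρ j), Finsupp.linearCombination_apply,
        Finsupp.sum]
      exact Finset.sum_congr rfl fun a _ => (Rat.smul_def _ _).symm
    rw [Set.mem_preimage, hf]
    exact hρ j
  obtain ⟨_, hq, q, rfl⟩ := (DenseRange.piMap fun _ : Module.Basis.ofVectorSpaceIndex ℚ ℝ =>
    Rat.denseRange_cast (𝕜 := ℝ)).inter_open_nonempty _ hopen ⟨_, hmem⟩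
  refine ⟨B.constr ℚ q, fun j => ?_⟩
  have hconstr : ((B.constr ℚ q (ρ j) : ℚ) : ℝ) = f j (Pi.map (fun _ => Rat.cast) q) := by
    rw [Module.Basis.constr_apply, Finsupp.sum]
    push_cast [smul_eq_mul]
    rfl
  rw [← Rat.cast_pos (K := ℝ), hconstr]
  exact Set.mem_iInter.1 hq j

theorem exists_ratLinearMap_nonneg {ι : Type*} [Finite ι] {ρ : ι → ℝ} (hρ : ∀ j, 0 ≤ ρ j) :
    ∃ φ : ℝ →ₗ[ℚ] ℚ, φ 1 = 1 ∧ ∀ j, 0 ≤ φ (ρ j) ∧ (φ (ρ j) = 0 ↔ ρ j = 0) := by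
  obtain ⟨φ, hφ⟩ := exists_ratLinearMap_pos (ι := Option {j // ρ j ≠ 0})
    (ρ := fun o => o.elim 1 fun j => ρ j)
    (Option.rec one_pos fun j => (hρ j).lt_of_ne' j.2)
  refine ⟨(φ 1)⁻¹ • φ, inv_mul_cancel₀ (hφ none).ne', fun j => ?_⟩
  by_cases hj : ρ j = 0
  · simp [hj]
  · have hpos : 0 < ((φ 1)⁻¹ • φ) (ρ j) := mul_pos (inv_pos.2 (hφ none)) (hφ (some ⟨j, hj⟩))
    exact ⟨hpos.le, iff_of_false hpos.ne' hj⟩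

theorem exists_natCast_eq_mul {ι : Type*} [Finite ι] {q : ι → ℚ} (hq : ∀ j, 0 ≤ q j) :
    ∃ N : ℕ, 0 < N ∧ ∃ m : ι → ℕ, ∀ j, (m j : ℚ) = N * q j := by
  cases nonempty_fintype ι
  refine ⟨∏ j, (q j).den, Finset.prod_pos fun j _ => (q j).den_pos, ?_⟩
  refine Classical.axiom_of_choice (r := fun j (m : ℕ) => (m : ℚ) = _) fun j => ?_
  obtain ⟨d, hd⟩ := Finset.dvd_prod_of_mem (fun j => (q j).den) (Finset.mem_univ j)
  obtain ⟨a, ha⟩ := Int.eq_ofNat_of_zero_le (Rat.num_nonneg.2 (hq j))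
  refine ⟨d * a, ?_⟩
  have hden := Rat.den_mul_eq_num (q j)
  rw [ha, Int.cast_natCast] at hden
  rw [hd, Nat.cast_mul, Nat.cast_mul, ← hden]
  ring

theorem barycenter_apply (c : PluckerIndex r n → ℝ) (i : Fin n) :
    barycenter c i = ∑ I : PluckerIndex r n with i ∈ I.1, c I := by
  rw [barycenter, Fintype.linearCombination_apply, Finset.sum_apply]
  simp [indicatorPoint, Finset.sum_filter]

theorem exists_invariantExponent {c : PluckerIndex r n → ℝ}
    (hc : c ∈ stdSimplex ℝ (PluckerIndex r n)) (hcb : ∀ i, barycenter c i ≤ b i) :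
    ∃ (N : ℕ) (u : Coord r n →₀ ℕ), 0 < N ∧ IsInvariantExponent b N u ∧
      (∀ i, u (Sum.inl i) = 0 ↔ barycenter c i = b i) ∧ ∀ I, u (Sum.inr I) = 0 ↔ c I = 0 := by
  obtain ⟨φ, hφ1, hφ⟩ := exists_ratLinearMap_nonneg
    (ρ := Sum.elim (fun i => b i - barycenter c i) c) (Sum.rec (fun i => sub_nonneg.2 (hcb i)) hc.1)
  obtain ⟨N, hN, m, hm⟩ := exists_natCast_eq_mul fun j => (hφ j).1
  have hφb : ∀ q : ℚ, φ (q : ℝ) = q := fun q => by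
    rw [← mul_one (q : ℝ), ← Rat.smul_def, map_smul, hφ1, smul_eq_mul, mul_one]
  have hzero : ∀ j, m j = 0 ↔ Sum.elim (fun i => (b i : ℝ) - barycenter c i) c j = 0 := fun j => by
    rw [← (hφ j).2, ← Nat.cast_eq_zero (R := ℚ), hm, mul_eq_zero,
      or_iff_right (Nat.cast_ne_zero.2 hN.ne')]
  refine ⟨N, Finsupp.equivFunOnFinite.symm m, hN, ⟨fun i => ?_, ?_⟩, fun i => ?_,
    fun I => hzero (Sum.inr I)⟩
  · simp only [weight_character_apply, Finsupp.equivFunOnFinite_symm_apply_apply, Nat.cast_add,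
      Nat.cast_sum, hm, Sum.elim_inl, Sum.elim_inr]
    rw [← Finset.mul_sum, ← map_sum, ← barycenter_apply, ← mul_add, ← map_add, sub_add_cancel, hφb]
  · rw [← Nat.cast_inj (R := ℚ)]
    simp only [weight_bidegree_snd, Finsupp.equivFunOnFinite_symm_apply_apply, Nat.cast_sum, hm,
      Sum.elim_inr]
    rw [← Finset.mul_sum, ← map_sum, hc.2, hφ1, mul_one]
  · exact (hzero (Sum.inl i)).trans (sub_eq_zero.trans eq_comm)

theorem IsInvariantExponent.div_mem_stdSimplex (hN : 0 < N) (hu : IsInvariantExponent b N u) :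
    (fun I => (u (Sum.inr I) / N : ℝ)) ∈ stdSimplex ℝ (PluckerIndex r n) := by
  refine ⟨fun I => by positivity, ?_⟩
  rw [← Finset.sum_div, ← Nat.cast_sum, ← weight_bidegree_snd, hu.2,
    div_self (Nat.cast_ne_zero.2 hN.ne')]

theorem IsInvariantExponent.barycenter_div (hN : 0 < N) (hu : IsInvariantExponent b N u)
    (i : Fin n) :
    barycenter (fun I => (u (Sum.inr I) / N : ℝ)) i = b i - u (Sum.inl i) / N := by
  have h := congrArg (Rat.cast : ℚ → ℝ) (hu.1 i)
  rw [weight_character_apply] at h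
  push_cast at h
  rw [barycenter_apply, ← Finset.sum_div, eq_sub_iff_add_eq, ← add_div,
    div_eq_iff (Nat.cast_ne_zero.2 hN.ne'), add_comm, h, mul_comm]

theorem isSemistable_iff_exists_mem_matroidPolytope {A : Type*} [CommRing A] [Algebra A k]
    {x : UniversalFamily k r n} : IsSemistable A b x ↔ ∃ y ∈ matroidPolytope x.space,
      (∀ i, y i ≤ b i) ∧ ∀ i, x.point.rep i = 0 → y i = b i := by
  rw [isSemistable_iff_exists_exponent]
  constructor
  · rintro ⟨N, u, hN, hu, hsupp⟩
    refine ⟨_, barycenter_mem_matroidPolytope ⟨hu.div_mem_stdSimplex hN, fun I hI => ?_⟩,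
      fun i => ?_, fun i hi => ?_⟩
    · simp [hsupp (Sum.inr I) hI]
    · rw [hu.barycenter_div hN, sub_le_self_iff]
      positivity
    · simp [hu.barycenter_div hN, hsupp (Sum.inl i) hi]
  · rw [matroidPolytope_eq_image]
    rintro ⟨_, ⟨c, hc, rfl⟩, hle, heq⟩
    obtain ⟨N, u, hN, hu, hl, hr⟩ := exists_invariantExponent hc.1 hle
    exact ⟨N, u, hN, hu, Sum.rec (fun i hi => (hl i).2 (heq i hi)) fun I hI =>
      (hr I).2 (hc.2 I hI)⟩

end Semistable

section LogCanonical

variable {A : Type*} [CommRing A] {k : Type*} [Field k] [Algebra A k] {r n : ℕ} {b : Fin n → ℚ}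
  {x : UniversalFamily k r n}

theorem point_le_intersection_iff {C : Finset (Fin n)} :
    x.point.submodule ≤ intersection x.space C ↔ ∀ i ∈ C, x.point.rep i = 0 := by
  rw [Projectivization.submodule_eq, Submodule.span_singleton_le_iff_mem, mem_intersection]
  exact and_iff_right (rep_mem x)

theorem codim_singleton_eq_zero {V : Gr k r n} {i : Fin n} (h : V.1 ≤ coordHyperplane k i) :
    codim V {i} = 0 := by
  have hV : intersection V {i} = V.1 := by
    simpa [intersection] using h
  rw [codim, hV, sub_self]

theorem isLCAt_iff (hb : ∀ i, 0 < b i) :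
    IsLCAt b x ↔ ∀ C : Finset (Fin n), C.Nonempty → (∀ i ∈ C, x.point.rep i = 0) →
      ∑ i ∈ C, b i ≤ codim x.space C := by
  simp only [← point_le_intersection_iff]
  refine ⟨And.right, fun h => ⟨fun i _ hi => (hb i).not_ge ?_, h⟩⟩
  have hle := h {i} (Finset.singleton_nonempty i)
    (point_le_intersection_iff.2 (by simpa using show x.point.rep i = 0 from hi (rep_mem x)))
  rwa [Finset.sum_singleton, codim_singleton_eq_zero hi] at hle

theorem isKLTAt_iff (hb : ∀ i, 0 < b i) :
    IsKLTAt b x ↔ ∀ C : Finset (Fin n), C.Nonempty → (∀ i ∈ C, x.point.rep i = 0) →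
      ∑ i ∈ C, b i < codim x.space C := by
  refine ⟨fun h C hC hz => h.2 C hC (point_le_intersection_iff.2 hz), fun h => ?_⟩
  have hlc : IsLCAt b x := (isLCAt_iff hb).2 fun C hC hz => (h C hC hz).le
  exact ⟨hlc.1, fun C hC hz => h C hC (point_le_intersection_iff.1 hz)⟩

theorem not_isSemistable_of_inter_eq_empty
    (h : matroidPolytope x.space ∩ weightedHypersimplex r b = ∅) : ¬ IsSemistable A b x := by
  rw [isSemistable_iff_exists_mem_matroidPolytope]
  rintro ⟨y, hy, hle, -⟩
  exact Set.eq_empty_iff_forall_notMem.1 h y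
    ⟨hy, fun i => ⟨nonneg_of_mem_matroidPolytope hy i, hle i⟩, sum_eq_of_mem_matroidPolytope hy⟩

theorem IsSemistable.isLCAt (hb : ∀ i, 0 < b i) (hx : IsSemistable A b x) : IsLCAt b x := by
  obtain ⟨y, hy, -, heq⟩ := isSemistable_iff_exists_mem_matroidPolytope.1 hx
  refine (isLCAt_iff hb).2 fun C _ hz => ?_
  have hsum := sum_le_codim hy C
  rw [Finset.sum_congr rfl fun i hi => heq i (hz i hi)] at hsum
  exact_mod_cast hsum

theorem isSemistable_iff_isLCAt (hb : ∀ i, 0 < b i)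
    (hne : (matroidPolytope x.space ∩ weightedHypersimplex r b).Nonempty) :
    IsSemistable A b x ↔ IsLCAt b x := by
  classical
  refine ⟨IsSemistable.isLCAt hb, fun hlc => ?_⟩
  obtain ⟨y, hy, hle, heq⟩ := exists_le_and_eqOn (V := x.space) (b := fun i => (b i : ℝ))
    (Z := {i | x.point.rep i = 0}) (hne.mono fun y hy => ⟨hy.1, fun i => (hy.2.1 i).2⟩)
    fun C hCZ hC => by
      exact_mod_cast (isLCAt_iff hb).1 hlc C hC fun i hi => (Finset.mem_filter.1 (hCZ hi)).2
  exact isSemistable_iff_exists_mem_matroidPolytope.2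
    ⟨y, hy, hle, fun i hi => heq i (Finset.mem_filter.2 ⟨Finset.mem_univ i, hi⟩)⟩

end LogCanonical

section Degeneration

variable {k : Type*} [Field k] {r n : ℕ} {V : Gr k r n} {C : Finset (Fin n)}

/-- The one-parameter subgroup of `𝔾_mⁿ` with weight `0` on `C` and weight `1` off `C`, evaluated
at an element `τ` of an arbitrary monoid, so that it also makes sense at `τ = 0` and at a
polynomial variable. -/
def oneParameter {M : Type*} [One M] (C : Finset (Fin n)) (τ : M) : Fin n → M :=
  fun i => if i ∈ C then 1 else τ

variable (V C) in
/-- A chosen linear projection of `kⁿ` onto the vectors of `V` that vanish on `C`. -/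
def projection : (Fin n → k) →ₗ[k] Fin n → k :=
  (intersection V C).projection _ (Submodule.exists_isCompl (intersection V C)).choose_spec

theorem projection_apply_mem (v : Fin n → k) : projection V C v ∈ intersection V C :=
  Submodule.projection_apply_mem _ v

theorem projection_of_mem {v : Fin n → k} (hv : v ∈ intersection V C) : projection V C v = v :=
  Submodule.projection_apply_of_mem_left _ hv

variable (V C) in
/-- The linear map whose restriction to `V` has as image the translate of `V` under
`oneParameter C τ` if `τ ≠ 0`, and the limit of these translates if `τ = 0`. -/
def degeneration (τ : k) : (Fin n → k) →ₗ[k] Fin n → k :=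
  projection V C + LinearMap.mulLeft k (oneParameter C τ) ∘ₗ (LinearMap.id - projection V C)

theorem degeneration_apply (τ : k) (v : Fin n → k) : degeneration V C τ v =
    projection V C v + oneParameter C τ * (v - projection V C v) := rfl

theorem degeneration_of_mem (τ : k) {v : Fin n → k} (hv : v ∈ intersection V C) :
    degeneration V C τ v = v := by
  rw [degeneration_apply, projection_of_mem hv, sub_self, mul_zero, add_zero]

theorem degeneration_apply_of_mem (τ : k) (v : Fin n → k) {i : Fin n} (hi : i ∈ C) :
    degeneration V C τ v i = v i := by
  simp [degeneration_apply, oneParameter, hi]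

theorem disjoint_ker_degeneration (τ : k) :
    Disjoint V.1 (LinearMap.ker (degeneration V C τ)) := by
  refine LinearMap.disjoint_ker.2 fun v hv h0 => ?_
  have hmem : v ∈ intersection V C := mem_intersection.2
    ⟨hv, fun i hi => by rw [← degeneration_apply_of_mem τ v hi, h0, Pi.zero_apply]⟩
  rwa [degeneration_of_mem τ hmem] at h0

theorem oneParameter_smul_degeneration (σ : kˣ) (τ : k) (v : Fin n → k) :
    oneParameter C σ • degeneration V C τ v =
      degeneration V C (σ * τ) (v + ((σ : k) - 1) • projection V C v) := by
  have hP := projection_apply_mem (V := V) (C := C) v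
  have hPv : projection V C (v + ((σ : k) - 1) • projection V C v) =
      (σ : k) • projection V C v := by
    rw [map_add, map_smul, projection_of_mem hP, sub_smul, one_smul, add_sub_cancel]
  funext i
  by_cases hi : i ∈ C
  · rw [degeneration_apply_of_mem _ _ hi, Pi.smul_apply', degeneration_apply_of_mem _ _ hi]
    simp [oneParameter, hi, (mem_intersection.1 hP).2 i hi]
  · rw [degeneration_apply, degeneration_apply, hPv]
    simp only [oneParameter, hi, if_false, Pi.smul_apply', Pi.add_apply, Pi.mul_apply, Pi.sub_apply,
      Pi.smul_apply, smul_eq_mul, Units.smul_def]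
    ring

variable (V C) in
/-- The image of `V` under `degeneration V C τ`. At `τ = 1` it is `V`, and at `τ = 0` it is the
limit of `V` under the one-parameter subgroup. -/
def degenerate (τ : k) : Gr k r n :=
  ⟨V.1.map (degeneration V C τ), by
    rw [← LinearMap.range_domRestrict, LinearMap.finrank_range_of_inj, V.2]
    exact Set.injOn_iff_injective.1
      (LinearMap.disjoint_ker_iff_injOn.1 (disjoint_ker_degeneration τ))⟩

theorem degenerate_one : degenerate V C 1 = V := by
  have hid : degeneration V C (1 : k) = LinearMap.id := by
    ext v i
    simp [degeneration_apply, oneParameter]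
  refine Subtype.ext ?_
  change V.1.map (degeneration V C 1) = V.1
  rw [hid, Submodule.map_id]

theorem oneParameter_smul_degenerate (σ : kˣ) (τ : k) :
    oneParameter C σ • (degenerate V C τ).1 = (degenerate V C (σ * τ)).1 := by
  refine Submodule.eq_of_le_of_finrank_eq ?_ ?_
  · rintro _ ⟨_, ⟨v, hv, rfl⟩, rfl⟩
    have hP := (mem_intersection.1 (projection_apply_mem (V := V) (C := C) v)).1
    exact ⟨_, add_mem hv (V.1.smul_mem _ hP), (oneParameter_smul_degeneration σ τ v).symm⟩
  · have hfinrank := LinearEquiv.finrank_map_eq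
      (DistribMulAction.toLinearEquiv k (Fin n → k) (oneParameter C σ)) (degenerate V C τ).1
    exact hfinrank.trans ((degenerate V C τ).2.trans (degenerate V C (σ * τ)).2.symm)

theorem IsBase.degenerate {I : Finset (Fin n)} (hI : IsBase V I)
    (h : ((I ∩ C).card : ℚ) = codim V C) (τ : k) : IsBase (degenerate V C τ) I := by
  have hIC : intersection V C = intersection V (I ∩ C) := by
    refine Submodule.eq_of_le_of_finrank_eq (intersection_anti Finset.inter_subset_right) ?_
    rw [← hI.codim_subset Finset.inter_subset_left, codim, codim, sub_right_inj] at h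
    exact_mod_cast h.symm
  refine ⟨hI.1, ?_⟩
  rintro _ ⟨v, hv, rfl⟩ h0
  have hmem : v ∈ intersection V C := by
    rw [hIC, mem_intersection]
    refine ⟨hv, fun i hi => ?_⟩
    rw [Finset.mem_inter] at hi
    rw [← degeneration_apply_of_mem τ v hi.2, h0 i hi.1]
  rw [degeneration_of_mem τ hmem] at h0 ⊢
  exact hI.2 v hv h0

theorem exists_polynomial_eval_eq_degeneration (v : Fin n → k) :
    ∃ p : Fin n → Polynomial k, ∀ τ i, (p i).eval τ = degeneration V C τ v i := by
  refine ⟨fun i => .C (projection V C v i) + oneParameter C .X i * .C (v i - projection V C v i),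
    fun τ i => ?_⟩
  by_cases hi : i ∈ C <;> simp [degeneration_apply, oneParameter, hi]

namespace UniversalFamily

variable (x : UniversalFamily k r n) (hC : ∀ i ∈ C, x.point.rep i = 0)

/-- The path through `x` that keeps the point of `ℙⁿ⁻¹` and degenerates the linear space. -/
def degenerate (τ : k) : UniversalFamily k r n where
  point := x.point
  space := HyperplaneGIT.degenerate x.space C τ
  point_mem := by
    rw [Projectivization.submodule_eq, Submodule.span_singleton_le_iff_mem]
    exact ⟨_, rep_mem x, degeneration_of_mem τ (mem_intersection.2 ⟨rep_mem x, hC⟩)⟩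

theorem degenerate_one : x.degenerate hC 1 = x :=
  UniversalFamily.ext rfl HyperplaneGIT.degenerate_one

include hC in
theorem oneParameter_smul_point (σ : kˣ) : oneParameter C σ • x.point = x.point := by
  have hrep : oneParameter C σ • x.point.rep = (σ : k) • x.point.rep := by
    funext i
    by_cases hi : i ∈ C
    · simp [hC i hi]
    · simp [oneParameter, hi, Units.smul_def]
  rw [← x.point.mk_rep, Projectivization.smul_mk, Projectivization.mk_eq_mk_iff']
  exact ⟨σ, hrep.symm⟩

theorem oneParameter_smul_degenerate (σ : kˣ) (τ : k) :
    oneParameter C σ • x.degenerate hC τ = x.degenerate hC (σ * τ) :=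
  UniversalFamily.ext (oneParameter_smul_point x hC σ)
    (Subtype.ext (HyperplaneGIT.oneParameter_smul_degenerate σ τ))

theorem exists_polynomial_isHomogeneousCoord : ∃ p : Coord r n → Polynomial k,
    ∀ τ, IsHomogeneousCoord (x.degenerate hC τ) fun j => (p j).eval τ := by
  choose p hp using fun a => exists_polynomial_eval_eq_degeneration (V := x.space) (C := C)
    (basisRows x.space a)
  refine ⟨Sum.elim (fun i => .C (x.point.rep i)) fun I =>
    Matrix.det (Matrix.of fun a c => p a (I.1.orderEmbOfFin I.2 c)), fun τ => ?_⟩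
  let w (a : Fin r) : (x.degenerate hC τ).space.1 :=
    ⟨degeneration x.space C τ (basisRows x.space a), Submodule.mem_map_of_mem (Subtype.prop _)⟩
  have hli : LinearIndependent k (degeneration x.space C τ ∘ basisRows x.space) :=
    (linearIndependent_basisRows x.space).map
      (by rw [span_basisRows]; exact disjoint_ker_degeneration τ)
  have hw : LinearIndependent k w := .of_comp (Submodule.subtype _) hli
  have hrep : x.point.rep ∈ (x.degenerate hC τ).point.submodule := by
    change x.point.rep ∈ x.point.submodule
    rw [Projectivization.submodule_eq]
    exact Submodule.mem_span_singleton_self _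
  convert isHomogeneousCoord hrep x.point.rep_nonzero hw using 1
  funext j
  rcases j with i | I
  · simp
  · simp only [Sum.elim_inr, minors, w, ← hp]
    rw [← Polynomial.coe_evalRingHom, RingHom.map_det]
    rfl

end UniversalFamily

theorem tendsto_cofinite_nhds_of_isHomogeneousCoord_eval {y : k → UniversalFamily k r n}
    {p : Coord r n → Polynomial k} (hp : ∀ τ, IsHomogeneousCoord (y τ) fun j => (p j).eval τ)
    (τ₀ : k) : Filter.Tendsto y Filter.cofinite (nhds (y τ₀)) := by
  rw [TopologicalSpace.tendsto_nhds_generateFrom_iff]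
  rintro _ ⟨d, F, hF, rfl⟩ hτ₀
  have heval (τ : k) : (MvPolynomial.aeval p F).eval τ ≠ 0 ↔
      MvPolynomial.aeval (y τ).coord F ≠ 0 := by
    rw [← (hp τ).aeval_ne_zero_iff hF, ← Polynomial.coe_aeval_eq_eval,
      MvPolynomial.comp_aeval_apply]
  have hne : MvPolynomial.aeval p F ≠ 0 := fun h0 =>
    (heval τ₀).2 hτ₀ (by rw [h0, Polynomial.eval_zero])
  refine (Polynomial.finite_setOfPred_isRoot hne).subset fun τ hτ => ?_
  exact not_not.1 (mt (heval τ).1 hτ)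

end Degeneration

section StableImpliesKLT

variable {A : Type*} [CommRing A] {k : Type*} [Field k] [Algebra A k] {r n : ℕ} {b : Fin n → ℚ}
  {x : UniversalFamily k r n} {C : Finset (Fin n)}

theorem mem_orbit_torus_iff {y : UniversalFamily k r n} :
    y ∈ MulAction.orbit (Torus k n) x ↔ ∃ t : Fin n → kˣ, t • x = y :=
  (QuotientGroup.mk_surjective (s := diagonal k n)).exists

theorem IsSemistable.smul (hx : IsSemistable A b x) (t : Fin n → kˣ) :
    IsSemistable A b (t • x) := by
  obtain ⟨N, u, hN, hu, hsupp⟩ := isSemistable_iff_exists_exponent.1 hx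
  obtain ⟨μ, ν, h⟩ := coord_smul t x
  refine isSemistable_iff_exists_exponent.2 ⟨N, u, hN, hu, fun j hj => hsupp j ?_⟩
  rw [h, mul_eq_zero] at hj
  exact hj.resolve_left (Units.ne_zero _)

theorem IsSemistable.isClosed_orbit_iff (hx : IsSemistable A b x) :
    IsClosed ((Subtype.val : {y : UniversalFamily k r n // IsSemistable A b y} → _) ⁻¹'
      MulAction.orbit (Torus k n) x) ↔
    ∀ y ∈ closure (MulAction.orbit (Torus k n) x), IsSemistable A b y →
      y ∈ MulAction.orbit (Torus k n) x := by
  have hsub : MulAction.orbit (Torus k n) x ⊆ {y | IsSemistable A b y} := by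
    intro y hy
    obtain ⟨t, rfl⟩ := mem_orbit_torus_iff.1 hy
    exact hx.smul t
  have h := isClosed_preimage_val (s := {y | IsSemistable A b y})
    (t := MulAction.orbit (Torus k n) x)
  rw [Set.inter_eq_self_of_subset_right hsub] at h
  exact h.trans ⟨fun h y hy hss => h ⟨hss, hy⟩, fun h y hy => h y hy.2 hy.1⟩

theorem IsSemistable.degenerate (hC : ∀ i ∈ C, x.point.rep i = 0) (hx : IsSemistable A b x)
    (htight : codim x.space C ≤ ∑ i ∈ C, b i) (τ : k) : IsSemistable A b (x.degenerate hC τ) := by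
  rw [isSemistable_iff_exists_mem_matroidPolytope] at hx ⊢
  obtain ⟨y, hy, hle, heq⟩ := hx
  refine ⟨y, ?_, hle, heq⟩
  rw [matroidPolytope_eq_image] at hy
  obtain ⟨c, hc, rfl⟩ := hy
  have hcodim : (codim x.space C : ℝ) ≤ ∑ i ∈ C, barycenter c i := by
    rw [Finset.sum_congr rfl fun i hi => heq i (hC i hi)]
    exact_mod_cast htight
  refine barycenter_mem_matroidPolytope ⟨hc.1, fun I => not_imp_not.1 fun hI => ?_⟩
  exact (plucker_ne_zero_iff I).2 ((isBase_of_mem_baseWeights hc hI).degenerate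
    (card_inter_eq_codim_of_le_sum_barycenter hc hcodim hI) τ)

theorem infinite_units [Infinite k] : Infinite kˣ :=
  unitsEquivNeZero.infinite_iff.2 (Set.finite_singleton (0 : k)).infinite_compl.to_subtype

theorem oneParameter_torus_injective (hC : C.Nonempty) (hC' : C ≠ Finset.univ) :
    Function.Injective fun τ : kˣ => (oneParameter C τ : Torus k n) := by
  intro σ τ h
  obtain ⟨c, hc⟩ := QuotientGroup.eq.1 h
  obtain ⟨i, hi⟩ := hC
  obtain ⟨j, hj⟩ : ∃ j, j ∉ C := by simpa [Finset.eq_univ_iff_forall] using hC'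
  have hci : c = 1 := by simpa [oneParameter, hi] using congrFun hc i
  have hcj : c = σ⁻¹ * τ := by simpa [oneParameter, hj] using congrFun hc j
  exact inv_mul_eq_one.1 (hcj.symm.trans hci)

theorem degenerate_mem_closure_orbit [Infinite k] (hC : ∀ i ∈ C, x.point.rep i = 0) :
    x.degenerate hC 0 ∈ closure (MulAction.orbit (Torus k n) x) := by
  obtain ⟨p, hp⟩ := x.exists_polynomial_isHomogeneousCoord hC
  refine mem_closure_of_tendsto (tendsto_cofinite_nhds_of_isHomogeneousCoord_eval hp 0) ?_
  filter_upwards [Filter.eventually_cofinite_ne (0 : k)] with τ hτ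
  refine mem_orbit_torus_iff.2 ⟨oneParameter C (Units.mk0 τ hτ), ?_⟩
  conv_lhs => rw [← x.degenerate_one hC]
  rw [x.oneParameter_smul_degenerate hC, Units.val_mk0, mul_one]

theorem IsStable.isKLTAt [Infinite k] (hb : ∀ i, 0 < b i) (hx : IsStable A b x) : IsKLTAt b x := by
  obtain ⟨hss, hclosed, hfin⟩ := hx
  refine (isKLTAt_iff hb).2 fun C hne hC => not_le.1 fun htight => ?_
  obtain ⟨t, ht⟩ := mem_orbit_torus_iff.1 (hss.isClosed_orbit_iff.1 hclosed _
    (degenerate_mem_closure_orbit hC) (hss.degenerate hC htight 0))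
  have hfix (σ : kˣ) : oneParameter C σ • x = x := by
    have hlim := x.oneParameter_smul_degenerate hC σ 0
    rw [mul_zero, ← ht, smul_comm] at hlim
    exact smul_left_cancel t hlim
  have hC' : C ≠ Finset.univ := by
    rintro rfl
    exact x.point.rep_nonzero (funext fun i => hC i (Finset.mem_univ i))
  have := infinite_units (k := k)
  exact (Infinite.of_injective
    (fun σ => (⟨oneParameter C σ, hfix σ⟩ : MulAction.stabilizer (Torus k n) x))
    (.of_comp (f := Subtype.val) (oneParameter_torus_injective hne hC'))).not_finite hfin

end StableImpliesKLT

section MonoidHom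

variable {ι G Q : Type*} [Fintype ι] [CommGroup G] [CommGroup Q]

theorem exists_mul_prod_pow_eq_of_mem_closure {a : ι → G} {S : Set ι} {z : G}
    (hz : z ∈ Subgroup.closure (a '' S)) : ∃ u v : ι →₀ ℕ,
      (∀ j ∉ S, u j = 0 ∧ v j = 0) ∧ z * ∏ j, a j ^ v j = ∏ j, a j ^ u j := by
  classical
  induction hz using Subgroup.closure_induction with
  | mem z hz =>
    obtain ⟨j, hj, rfl⟩ := hz
    refine ⟨Finsupp.single j 1, 0, fun i hi => ⟨?_, rfl⟩, ?_⟩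
    · exact Finsupp.single_eq_of_ne (ne_of_mem_of_not_mem hj hi).symm
    · simp [Finsupp.single_apply, pow_ite]
  | one => exact ⟨0, 0, fun _ _ => ⟨rfl, rfl⟩, by simp⟩
  | mul z w _ _ hz hw =>
    obtain ⟨u, v, h0, h⟩ := hz
    obtain ⟨u', v', h0', h'⟩ := hw
    refine ⟨u + u', v + v', fun j hj => by simp [h0 j hj, h0' j hj], ?_⟩
    simp only [Finsupp.add_apply, pow_add, Finset.prod_mul_distrib]
    rw [mul_mul_mul_comm, h, h']
  | inv z _ hz =>
    obtain ⟨u, v, h0, h⟩ := hz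
    exact ⟨v, u, fun j hj => (h0 j hj).symm, by rw [← h, inv_mul_cancel_left]⟩

theorem exists_monoidHom_apply_eq {S : Set ι} {a : ι → G} {q : ι → Q}
    (ha : Subgroup.closure (a '' S) = ⊤)
    (h : ∀ u v : ι →₀ ℕ, (∀ j ∉ S, u j = 0 ∧ v j = 0) →
      ∏ j, a j ^ u j = ∏ j, a j ^ v j → ∏ j, q j ^ u j = ∏ j, q j ^ v j) :
    ∃ χ : G →* Q, ∀ j ∈ S, χ (a j) = q j := by
  let K := Subgroup.closure ((fun j => (a j, q j)) '' S)
  have hsurj : K.map (MonoidHom.fst G Q) = ⊤ := by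
    rw [MonoidHom.map_closure, Set.image_image]
    exact ha
  have hinj : Function.Injective ((MonoidHom.fst G Q).comp K.subtype) := by
    refine (injective_iff_map_eq_one _).2 fun ⟨⟨g, w⟩, hz⟩ hg => ?_
    obtain ⟨u, v, h0, hz⟩ := exists_mul_prod_pow_eq_of_mem_closure hz
    obtain rfl : g = 1 := hg
    simp only [Prod.ext_iff, Prod.fst_mul, Prod.snd_mul, Prod.fst_prod, Prod.snd_prod, Prod.pow_fst,
      Prod.pow_snd, one_mul] at hz
    rw [h v u (fun j hj => (h0 j hj).symm) hz.1, mul_eq_right] at hz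
    exact Subtype.ext (Prod.ext rfl hz.2)
  obtain ⟨χ, hχ⟩ := Subgroup.exists_eq_graph (G := K) ⟨hinj, fun z => by
    obtain ⟨w, hw, rfl⟩ := hsurj.ge (Subgroup.mem_top z)
    exact ⟨⟨w, hw⟩, rfl⟩⟩
  refine ⟨χ, fun j hj => ?_⟩
  have hmem : (a j, q j) ∈ K := Subgroup.subset_closure (Set.mem_image_of_mem _ hj)
  rwa [hχ] at hmem

end MonoidHom

section Rigidity

variable {k : Type*} [Field k] {r n : ℕ} {b : Fin n → ℚ} {x : UniversalFamily k r n}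

theorem eq_of_scale_eq_of_exchange {G : Type*} [CommGroup G] {g : (Fin n → G) × G}
    {I J : PluckerIndex r n} {l j : Fin n} (hl : l ∉ I.1) (hj : j ∈ I.1)
    (hJ : J.1 = insert l (I.1.erase j))
    (h : scale g (Sum.inr I) = scale g (Sum.inr J)) : g.1 j = g.1 l := by
  rwa [scale_inr, scale_inr, hJ, mul_left_inj, ← Finset.mul_prod_erase _ _ hj,
    Finset.prod_insert fun hl' => hl (Finset.mem_of_mem_erase hl'), mul_left_inj] at h

theorem IsKLTAt.eq_one_of_scale_eq_one (hb : ∀ i, 0 < b i) (hx : IsKLTAt b x)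
    (hne : ∃ y ∈ matroidPolytope x.space, ∀ i, y i ≤ b i) {G : Type*} [CommGroup G]
    {g : (Fin n → G) × G} (hg : ∀ j, x.coord j ≠ 0 → scale g j = 1) : g = 1 := by
  classical
  rw [matroidPolytope_eq_image] at hne
  obtain ⟨_, ⟨c, hc, rfl⟩, hle⟩ := hne
  have hscale (I : PluckerIndex r n) (hI : IsBase x.space I.1) : scale g (Sum.inr I) = 1 :=
    hg (Sum.inr I) ((plucker_ne_zero_iff I).2 hI)
  have hfst : g.1 = 1 := by
    by_contra! hD
    obtain ⟨i, hi⟩ := Function.ne_iff.1 hD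
    refine (Finset.sum_le_sum fun i (_ : i ∈ ({i | g.1 i ≠ 1} : Finset _)) => hle i).not_gt ?_
    rw [sum_barycenter_eq_codim hc fun I hI l hl hlI j hj hbase => ?_]
    · exact_mod_cast (isKLTAt_iff hb).1 hx _ ⟨i, Finset.mem_filter_univ i |>.2 hi⟩
        fun i hi => not_not.1 (mt (hg (Sum.inl i)) (Finset.mem_filter_univ i |>.1 hi))
    · rw [Finset.mem_filter_univ] at hl ⊢
      rwa [eq_of_scale_eq_of_exchange (J := ⟨_, hbase.1⟩) hlI hj rfl
        ((hscale _ (isBase_of_mem_baseWeights hc hI)).trans (hscale _ hbase).symm)]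
  obtain ⟨I, hI⟩ := exists_isBase x.space
  refine Prod.ext hfst ?_
  simpa [hfst] using hscale ⟨I, hI.1⟩ hI

theorem map_scale {G H : Type*} [CommGroup G] [CommGroup H] (f : G →* H) (g : (Fin n → G) × G)
    (j : Coord r n) : f (scale g j) = scale (f ∘ g.1, f g.2) j := by
  rcases j with i | I <;> simp

/-- The character lattice of `𝔾_mⁿ × 𝔾_m`, written multiplicatively. -/
abbrev CharacterLattice (n : ℕ) : Type := (Fin n → Multiplicative ℤ) × Multiplicative ℤ

/-- The standard basis of the character lattice, regarded as a point of the torus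
`𝔾_mⁿ × 𝔾_m` with coordinates in this lattice: every other point, with coordinates in some group,
is its image under a unique homomorphism. -/
def tautologicalPoint (n : ℕ) : (Fin n → CharacterLattice n) × CharacterLattice n :=
  (fun i => (Pi.mulSingle i (.ofAdd 1), 1), (1, .ofAdd 1))

theorem prod_tautologicalPoint_zpow (z : CharacterLattice n) :
    (∏ i, (tautologicalPoint n).1 i ^ (z.1 i).toAdd) *
      (tautologicalPoint n).2 ^ z.2.toAdd = z := by
  ext i <;>
    simp [tautologicalPoint, Prod.fst_prod, Prod.snd_prod, Pi.mulSingle_apply, ← ofAdd_zsmul]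

theorem prod_scale_tautologicalPoint_pow (u : Coord r n →₀ ℕ) :
    ∏ j, scale (tautologicalPoint n) j ^ u j =
      (fun i => .ofAdd (Finsupp.weight (character r n) u i : ℤ),
        .ofAdd ((Finsupp.weight (bidegree r n) u).2 : ℤ)) := by
  rw [prod_scale_pow]
  simpa only [toAdd_ofAdd, zpow_natCast] using prod_tautologicalPoint_zpow
    (fun i => .ofAdd (Finsupp.weight (character r n) u i : ℤ),
      .ofAdd ((Finsupp.weight (bidegree r n) u).2 : ℤ))

theorem weight_eq_of_prod_scale_tautologicalPoint_eq {u v : Coord r n →₀ ℕ}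
    (h : ∏ j, scale (tautologicalPoint n) j ^ u j = ∏ j, scale (tautologicalPoint n) j ^ v j) :
    Finsupp.weight (character r n) u = Finsupp.weight (character r n) v ∧
      (Finsupp.weight (bidegree r n) u).2 = (Finsupp.weight (bidegree r n) v).2 := by
  rw [prod_scale_tautologicalPoint_pow, prod_scale_tautologicalPoint_pow] at h
  simpa [funext_iff] using h

theorem IsKLTAt.closure_scale_tautologicalPoint (hb : ∀ i, 0 < b i) (hx : IsKLTAt b x)
    (hne : ∃ y ∈ matroidPolytope x.space, ∀ i, y i ≤ b i) :
    Subgroup.closure (scale (tautologicalPoint n) '' {j : Coord r n | x.coord j ≠ 0}) = ⊤ := by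
  let K := Subgroup.closure (scale (tautologicalPoint n) '' {j : Coord r n | x.coord j ≠ 0})
  let π := QuotientGroup.mk' K
  have hone : (π ∘ (tautologicalPoint n).1, π (tautologicalPoint n).2) = 1 :=
    hx.eq_one_of_scale_eq_one hb hne fun j hj => by
      rw [← map_scale]
      exact (QuotientGroup.eq_one_iff _).2 (Subgroup.subset_closure (Set.mem_image_of_mem _ hj))
  rw [Prod.ext_iff] at hone
  refine (Subgroup.eq_top_iff' K).2 fun z => ?_
  rw [← prod_tautologicalPoint_zpow z]
  exact K.mul_mem (K.prod_mem fun i _ => K.zpow_mem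
    ((QuotientGroup.eq_one_iff _).1 (congrFun hone.1 i)) _)
    (K.zpow_mem ((QuotientGroup.eq_one_iff _).1 hone.2) _)

theorem IsKLTAt.exists_eq_scale (hb : ∀ i, 0 < b i) (hx : IsKLTAt b x)
    (hne : ∃ y ∈ matroidPolytope x.space, ∀ i, y i ≤ b i) {Q : Type*} [CommGroup Q]
    {q : Coord r n → Q} (hq : ∀ u v : Coord r n →₀ ℕ, (∀ j, x.coord j = 0 → u j = 0 ∧ v j = 0) →
      Finsupp.weight (character r n) u = Finsupp.weight (character r n) v →
      (Finsupp.weight (bidegree r n) u).2 = (Finsupp.weight (bidegree r n) v).2 →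
      ∏ j, q j ^ u j = ∏ j, q j ^ v j) :
    ∃ g : (Fin n → Q) × Q, ∀ j, x.coord j ≠ 0 → q j = scale g j := by
  obtain ⟨χ, hχ⟩ := exists_monoidHom_apply_eq (q := q) (hx.closure_scale_tautologicalPoint hb hne)
    fun u v hsupp huv => hq u v (fun j hj => hsupp j (not_not.2 hj))
      (weight_eq_of_prod_scale_tautologicalPoint_eq huv).1
      (weight_eq_of_prod_scale_tautologicalPoint_eq huv).2
  exact ⟨(χ ∘ (tautologicalPoint n).1, χ (tautologicalPoint n).2), fun j hj => by
    rw [← map_scale, hχ j hj]⟩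

theorem IsKLTAt.mem_diagonal_of_smul_eq (hb : ∀ i, 0 < b i) (hx : IsKLTAt b x)
    (hne : ∃ y ∈ matroidPolytope x.space, ∀ i, y i ≤ b i) {t : Fin n → kˣ} (ht : t • x = x) :
    t ∈ diagonal k n := by
  obtain ⟨μ, ν, h⟩ := coord_smul t x
  have hone := hx.eq_one_of_scale_eq_one hb hne (g := ((fun _ => μ) * t, ν)) fun j hj => by
    rw [← Units.val_eq_one, ← mul_left_inj' hj, ← h, ht, one_mul]
  exact ⟨μ⁻¹, funext fun i => inv_eq_of_mul_eq_one_right (congrFun (congrArg Prod.fst hone) i)⟩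

theorem IsKLTAt.subsingleton_stabilizer (hb : ∀ i, 0 < b i) (hx : IsKLTAt b x)
    (hne : ∃ y ∈ matroidPolytope x.space, ∀ i, y i ≤ b i) :
    Subsingleton (MulAction.stabilizer (Torus k n) x) := by
  refine subsingleton_of_forall_eq 1 fun ⟨t, ht⟩ => Subtype.ext ?_
  obtain ⟨t, rfl⟩ := QuotientGroup.mk_surjective t
  exact (QuotientGroup.eq_one_iff t).2 (hx.mem_diagonal_of_smul_eq hb hne ht)

end Rigidity

section OrbitClosure

variable {k : Type*} [Field k] {r n : ℕ} {b : Fin n → ℚ} {x y : UniversalFamily k r n}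
  {u v : Coord r n →₀ ℕ}

theorem aeval_coord_eq_zero_of_mem_closure_orbit
    (hy : y ∈ closure (MulAction.orbit (Torus k n) x)) {F : MvPolynomial (Coord r n) k} {d : ℕ × ℕ}
    (hF : MvPolynomial.IsWeightedHomogeneous (bidegree r n) F d)
    (h0 : ∀ t : Fin n → kˣ, MvPolynomial.aeval (t • x).coord F = 0) :
    MvPolynomial.aeval y.coord F = 0 := by
  by_contra hne
  obtain ⟨_, hz, hmem⟩ := mem_closure_iff.1 hy _
    (TopologicalSpace.isOpen_generateFrom_of_mem ⟨d, F, hF, rfl⟩) hne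
  obtain ⟨t, rfl⟩ := mem_orbit_torus_iff.1 hmem
  exact hz (h0 t)

theorem coord_eq_zero_of_mem_closure_orbit (hy : y ∈ closure (MulAction.orbit (Torus k n) x))
    {j : Coord r n} (hj : x.coord j = 0) : y.coord j = 0 := by
  have h := aeval_coord_eq_zero_of_mem_closure_orbit hy
    (MvPolynomial.isWeightedHomogeneous_X k (bidegree r n) j) fun t => by
      obtain ⟨μ, ν, h⟩ := coord_smul t x
      rw [MvPolynomial.aeval_X, h, hj, mul_zero]
  rwa [MvPolynomial.aeval_X] at h

theorem prod_coord_pow_mul_smul (t : Fin n → kˣ)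
    (hchar : Finsupp.weight (character r n) u = Finsupp.weight (character r n) v)
    (hdeg : (Finsupp.weight (bidegree r n) u).2 = (Finsupp.weight (bidegree r n) v).2) :
    (∏ j, x.coord j ^ u j) * ∏ j, (t • x).coord j ^ v j =
      (∏ j, x.coord j ^ v j) * ∏ j, (t • x).coord j ^ u j := by
  obtain ⟨μ, ν, h⟩ := coord_smul t x
  have hscale := congrArg (Units.val (α := k)) (prod_scale_pow ((fun _ => μ) * t, ν) u)
  rw [hchar, hdeg, ← prod_scale_pow] at hscale
  push_cast at hscale
  simp only [h, mul_pow, Finset.prod_mul_distrib, hscale]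
  ring

theorem prod_coord_pow_mul_of_mem_closure_orbit
    (hy : y ∈ closure (MulAction.orbit (Torus k n) x))
    (hchar : Finsupp.weight (character r n) u = Finsupp.weight (character r n) v)
    (hdeg : (Finsupp.weight (bidegree r n) u).2 = (Finsupp.weight (bidegree r n) v).2) :
    (∏ j, x.coord j ^ u j) * ∏ j, y.coord j ^ v j =
      (∏ j, x.coord j ^ v j) * ∏ j, y.coord j ^ u j := by
  have hbideg : Finsupp.weight (bidegree r n) u = Finsupp.weight (bidegree r n) v := by
    have hsum := sum_weight_character u
    rw [hchar, sum_weight_character, hdeg, add_left_inj] at hsum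
    exact Prod.ext hsum.symm hdeg
  let F := MvPolynomial.monomial v (∏ j, x.coord j ^ u j) -
    MvPolynomial.monomial u (∏ j, x.coord j ^ v j)
  have hF (z : Coord r n → k) : MvPolynomial.aeval z F = (∏ j, x.coord j ^ u j) * ∏ j, z j ^ v j -
      (∏ j, x.coord j ^ v j) * ∏ j, z j ^ u j := by
    simp only [F, map_sub, MvPolynomial.aeval_monomial, Algebra.algebraMap_self, RingHom.id_apply]
    rw [Finsupp.prod_fintype _ _ fun _ => pow_zero _, Finsupp.prod_fintype _ _ fun _ => pow_zero _]
  rw [← sub_eq_zero, ← hF]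
  refine aeval_coord_eq_zero_of_mem_closure_orbit hy
    ((MvPolynomial.isWeightedHomogeneous_monomial _ _ _ rfl).sub
      (MvPolynomial.isWeightedHomogeneous_monomial _ _ _ hbideg)) fun t => ?_
  rw [hF, prod_coord_pow_mul_smul t hchar hdeg, sub_self]

theorem prod_coord_pow_ne_zero_iff :
    ∏ j, x.coord j ^ u j ≠ 0 ↔ ∀ j, x.coord j = 0 → u j = 0 := by
  simp only [Finset.prod_ne_zero_iff, Finset.mem_univ, true_imp_iff, ne_eq, pow_eq_zero_iff',
    not_and, not_not]

theorem IsSemistable.coord_ne_zero_of_mem_closure_orbit {A : Type*} [CommRing A] [Algebra A k]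
    (hss : IsSemistable A b y) (hy : y ∈ closure (MulAction.orbit (Torus k n) x)) {N : ℕ}
    (hu : IsInvariantExponent b N u) (hsupp : ∀ j, u j = 0 ↔ x.coord j = 0) {j : Coord r n}
    (hj : x.coord j ≠ 0) : y.coord j ≠ 0 := by
  obtain ⟨M, v, hM, hv, hvsupp⟩ := isSemistable_iff_exists_exponent.1 hss
  have hprod := prod_coord_pow_mul_of_mem_closure_orbit hy (u := M • u) (v := N • v)
    (by
      ext i
      rw [map_nsmul, map_nsmul, Pi.smul_apply, Pi.smul_apply, ← Nat.cast_inj (R := ℚ)]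
      push_cast [nsmul_eq_mul, hu.1, hv.1]
      ring)
    (by simp only [map_nsmul, Prod.smul_snd, hu.2, hv.2, smul_eq_mul, mul_comm])
  have hne : ∏ j, y.coord j ^ (M • u) j ≠ 0 := by
    refine right_ne_zero_of_mul (hprod ▸ mul_ne_zero ?_ ?_)
    · exact prod_coord_pow_ne_zero_iff.2 fun j hj => by simp [(hsupp j).2 hj]
    · exact prod_coord_pow_ne_zero_iff.2 fun j hj => by simp [hvsupp j hj]
  intro hyj
  have hMu := prod_coord_pow_ne_zero_iff.1 hne j hyj
  exact hj ((hsupp j).1 ((mul_eq_zero.1 hMu).resolve_left hM.ne'))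

theorem IsKLTAt.mem_orbit_of_mem_closure_orbit (hb : ∀ i, 0 < b i) (hx : IsKLTAt b x)
    (hne : ∃ y ∈ matroidPolytope x.space, ∀ i, y i ≤ b i)
    (hy : y ∈ closure (MulAction.orbit (Torus k n) x))
    (hsupp : ∀ j, x.coord j ≠ 0 → y.coord j ≠ 0) : y ∈ MulAction.orbit (Torus k n) x := by
  have hratio : ∀ j, ∃ q : kˣ, y.coord j = q * x.coord j := fun j => by
    by_cases hj : x.coord j = 0
    · exact ⟨1, by rw [hj, coord_eq_zero_of_mem_closure_orbit hy hj, mul_zero]⟩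
    · exact ⟨.mk0 _ (div_ne_zero (hsupp j hj) hj), (div_mul_cancel₀ _ hj).symm⟩
  choose q hq using hratio
  obtain ⟨g, hg⟩ := hx.exists_eq_scale hb hne (q := q) fun u v huv hchar hdeg => by
    have hprod := prod_coord_pow_mul_of_mem_closure_orbit hy hchar hdeg
    have hu := prod_coord_pow_ne_zero_iff.2 fun j hj => (huv j hj).1
    have hv := prod_coord_pow_ne_zero_iff.2 fun j hj => (huv j hj).2
    simp only [hq, mul_pow, Finset.prod_mul_distrib] at hprod
    rw [mul_left_comm, mul_left_comm (∏ j, x.coord j ^ v j), mul_comm (∏ j, x.coord j ^ v j),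
      mul_left_inj' (mul_ne_zero hu hv)] at hprod
    ext
    push_cast
    exact hprod.symm
  refine mem_orbit_torus_iff.2 ⟨g.1, (eq_smul_of_coord_eq fun j => ?_).symm⟩
  by_cases hj : x.coord j = 0
  · rw [hq, hj, mul_zero, mul_zero]
  · rw [hq, hg j hj]

end OrbitClosure

section KLTImpliesStable

variable {A : Type*} [CommRing A] {k : Type*} [Field k] [Algebra A k] {r n : ℕ} {b : Fin n → ℚ}
  {x : UniversalFamily k r n}

theorem IsKLTAt.exists_invariantExponent (hb : ∀ i, 0 < b i) (hx : IsKLTAt b x)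
    (hne : ∃ y ∈ matroidPolytope x.space, ∀ i, y i < b i) : ∃ (N : ℕ) (u : Coord r n →₀ ℕ),
      0 < N ∧ IsInvariantExponent b N u ∧ ∀ j, u j = 0 ↔ x.coord j = 0 := by
  classical
  obtain ⟨c, hc, heq, hlt⟩ := exists_fullBaseWeights_eqOn (b := fun i => (b i : ℝ))
    (Z := {i | x.point.rep i = 0}) hne fun C hCZ hC => by
      exact_mod_cast (isKLTAt_iff hb).1 hx C hC fun i hi => (Finset.mem_filter_univ i).1 (hCZ hi)
  simp only [Finset.mem_filter_univ] at heq hlt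
  obtain ⟨N, u, hN, hu, hl, hr⟩ := HyperplaneGIT.exists_invariantExponent hc.1 (b := b) fun i =>
    (em _).elim (fun hi => (heq i hi).le) fun hi => (hlt i hi).le
  refine ⟨N, u, hN, hu, Sum.rec (fun i => (hl i).trans ⟨fun h => ?_, heq i⟩)
    fun I => (hr I).trans (hc.2 I)⟩
  exact not_not.1 fun hi => (hlt i hi).ne h

theorem IsKLTAt.isStable (hb : ∀ i, 0 < b i) (hx : IsKLTAt b x)
    (hne : ∃ y ∈ matroidPolytope x.space, ∀ i, y i < b i) : IsStable A b x := by
  obtain ⟨N, u, hN, hu, hsupp⟩ := hx.exists_invariantExponent hb hne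
  have hss : IsSemistable A b x :=
    isSemistable_iff_exists_exponent.2 ⟨N, u, hN, hu, fun j => (hsupp j).2⟩
  have hle : ∃ y ∈ matroidPolytope x.space, ∀ i, y i ≤ b i :=
    hne.imp fun y hy => ⟨hy.1, fun i => (hy.2 i).le⟩
  have := hx.subsingleton_stabilizer hb hle
  refine ⟨hss, hss.isClosed_orbit_iff.2 fun y hy hyss => ?_, inferInstance⟩
  exact hx.mem_orbit_of_mem_closure_orbit hb hle hy fun j =>
    hyss.coord_ne_zero_of_mem_closure_orbit hy hu hsupp

end KLTImpliesStable

end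

end HyperplaneGIT

theorem theorem6_general {A : Type*} [CommRing A] {k : Type*} [Field k] [Infinite k] [Algebra A k]
    {r n : ℕ} {b : Fin n → ℚ} (hb : ∀ i, 0 < b i) (hr : (r : ℚ) < ∑ i, b i) (V : Gr k r n) :
    ((matroidPolytope V ∩ weightedHypersimplex r b = ∅ ∨ ∃ i, V.1 ≤ coordHyperplane k i) →
      ∀ (p : ℙ k (Fin n → k)) (hp : p.submodule ≤ V.1),
        ¬ IsSemistable A b (⟨p, V, hp⟩ : UniversalFamily k r n)) ∧
    ((matroidPolytope V ∩ weightedHypersimplex r b).Nonempty →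
      ∀ (p : ℙ k (Fin n → k)) (hp : p.submodule ≤ V.1),
        IsSemistable A b (⟨p, V, hp⟩ : UniversalFamily k r n) ↔
          IsLCAt b (⟨p, V, hp⟩ : UniversalFamily k r n)) ∧
    ((matroidPolytope V ∩ intrinsicInterior ℝ (weightedHypersimplex r b)).Nonempty →
      ∀ (p : ℙ k (Fin n → k)) (hp : p.submodule ≤ V.1),
        IsStable A b (⟨p, V, hp⟩ : UniversalFamily k r n) ↔
          IsKLTAt b (⟨p, V, hp⟩ : UniversalFamily k r n)) := by
  refine ⟨?_, fun hne p hp => isSemistable_iff_isLCAt hb hne, ?_⟩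
  · rintro (hempty | ⟨i, hi⟩) p hp
    · exact not_isSemistable_of_inter_eq_empty hempty
    · exact fun hss => (hss.isLCAt hb).1 i (hb i).ne' hi
  · rintro ⟨y, hyV, hyb⟩ p hp
    exact ⟨IsStable.isKLTAt hb, fun hklt =>
      hklt.isStable hb ⟨y, hyV, lt_of_mem_intrinsicInterior hb hr hyb⟩⟩

theorem theorem6 {A : Type*} [CommRing A] {k : Type*} [Field k] [IsAlgClosed k] [Algebra A k]
    (r n : ℕ) (b : Fin n → ℚ) (hb : b ∈ weightDomain r n) (V : Gr k r n) :
    ((matroidPolytope V ∩ weightedHypersimplex r b = ∅ ∨ ∃ i, V.1 ≤ coordHyperplane k i) →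
      ∀ (p : ℙ k (Fin n → k)) (hp : p.submodule ≤ V.1),
        ¬ IsSemistable A b (⟨p, V, hp⟩ : UniversalFamily k r n)) ∧
    ((matroidPolytope V ∩ weightedHypersimplex r b).Nonempty →
      ∀ (p : ℙ k (Fin n → k)) (hp : p.submodule ≤ V.1),
        IsSemistable A b (⟨p, V, hp⟩ : UniversalFamily k r n) ↔
          IsLCAt b (⟨p, V, hp⟩ : UniversalFamily k r n)) ∧
    ((matroidPolytope V ∩ intrinsicInterior ℝ (weightedHypersimplex r b)).Nonempty →
      ∀ (p : ℙ k (Fin n → k)) (hp : p.submodule ≤ V.1),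
        IsStable A b (⟨p, V, hp⟩ : UniversalFamily k r n) ↔
          IsKLTAt b (⟨p, V, hp⟩ : UniversalFamily k r n)) :=
  theorem6_general (fun i => (hb.1 i).1) hb.2 V
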